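/- Let $H$ be an infinite-dimensional separable complex Hilbert space with a fixed orthonormal basis $(e_n)_{n\in\mathbb N}$, let $\mathcal B(H)$ be the algebra of bounded operators on $H$, $\mathcal K(H)$ the ideal of compact operators, $\mathcal C(H)=\mathcal B(H)/\mathcal K(H)$ the Calkin algebra and $\pi\colon\mathcal B(H)\to\mathcal C(H)$ the quotient map. A *-automorphism of $\mathcal C(H)$ is inner if it is of the form $x\mapsto uxu^*$ for a unitary $u\in\mathcal C(H)$, and outer otherwise; its restriction to $X\subseteq\mathcal C(H)$ is inner if it coincides on $X$ with some inner automorphism, and it is inner on $\mathcal D\subseteq\mathcal B(H)$ if its restriction to $\pi[\mathcal D]$ is inner. For a partition $\vec E=(E_n)_{n\in\mathbb N}$ of $\mathbb N$ into consecutive nonempty finite intervals let $\mathcal D[\vec E]$ be the algebra of all $a\in\mathcal B(H)$ for which each $\mathrm{span}\{e_i: i\in E_n\}$ is invariant; for $E_n=\{n\}$ this is the standard atomic masa. Let $\vec E^{\mathrm{even}}$ have the entries $E_{2n}\cup E_{2n+1}$ and $\vec E^{\mathrm{odd}}$ the entries $E_{2n-1}\cup E_{2n}$ (with $E_{-1}=\emptyset$),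 $n\ge 0$, and put $\mathcal F[\vec E]=\mathcal D[\vec E^{\mathrm{even}}]\cup\mathcal D[\vec E^{\mathrm{odd}}]$. Write $\vec E\le^*\vec F$ if for all but finitely many $i$ there is $j$ with $E_i\cup E_{i+1}\subseteq F_j\cup F_{j+1}$. For $\alpha\in\mathbb T^{\mathbb N}$, where $\mathbb T$ is the unit circle in $\mathbb C$, let $u_\alpha$ be the unitary operator with $u_\alpha e_n=\alpha(n)e_n$ and let $\Psi_\alpha(a)=u_\alpha a u_\alpha^*$. **Theorem.** Assume the Continuum Hypothesis. Then there is an outer *-automorphism $\Phi$ of $\mathcal C(H)$ such that $\Phi$ is inner on the standard atomic masa and on $\mathcal D[\vec E]$ for every partition $\vec E$ of $\mathbb N$ into consecutive nonempty finite intervals, and the restriction of $\Phi$ to every norm-separable subalgebra of $\mathcal C(H)$ is inner. Moreover, $\Phi$ can be chosen so that there are such partitions $\vec E^\xi$ and $\alpha^\xi\in\mathbb T^{\mathbb N}$, for $\xi<\omega_1$, with the following properties: 1. $\vec E^\xi\le^*\vec E^\eta$ whenever $\xi<\eta<\omega_1$, and for every partition $\vec F$ of $\mathbb N$ into consecutive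 nonempty finite intervals there is $\xi<\omega_1$ with $\vec F\le^*\vec E^\xi$; 2. for all $\xi\le\eta<\omega_1$ and all $a\in\mathcal F[\vec E^\xi]$ the operator $\Psi_{\alpha^\xi}(a)-\Psi_{\alpha^\eta}(a)$ is compact; 3. $\Phi(\pi(a))=\pi(\Psi_{\alpha^\xi}(a))$ for all $\xi<\omega_1$ and $a\in\mathcal F[\vec E^\xi]$, and $\Phi$ is the only *-automorphism of $\mathcal C(H)$ with this property. -/

import Mathlib

noncomputable section

namespace CalkinCH

/-! ### The Calkin algebra -/

section Calkin

set_option linter.unusedSectionVars false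

variable {H : Type*} [NormedAddCommGroup H] [InnerProductSpace ℂ H] [CompleteSpace H]

/-- The adjoint of a compact operator on a Hilbert space is compact. -/
theorem isCompactOperator_star {T : H →L[ℂ] H} (hT : IsCompactOperator T) :
    IsCompactOperator (star T : H →L[ℂ] H) := by
  have hTS : IsCompactOperator (T * star T : H →L[ℂ] H) := hT.comp_clm (star T)
  have hc := hTS.isCompact_closure_image_ball (f := (T * star T : H →L[ℂ] H).toLinearMap) 1
  have htb := hc.totallyBounded.subset subset_closure
  refine (isCompactOperator_iff_isCompact_closure_image_ball
    (star T : H →L[ℂ] H).toLinearMap one_pos).2 ?_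
  refine isCompact_iff_totallyBounded_isComplete.2
    ⟨TotallyBounded.closure ?_, isClosed_closure.isComplete⟩
  rw [Metric.totallyBounded_iff]
  intro ε hε
  obtain ⟨t, hts, htf, htc⟩ := totallyBounded_iff_subset.1 htb
    {p | dist p.1 p.2 < ε ^ 2 / 2} (Metric.dist_mem_uniformity (by positivity))
  have hts' : ∀ y ∈ t, ∃ x, x ∈ Metric.ball (0 : H) 1 ∧ T ((star T : H →L[ℂ] H) x) = y :=
    fun y hy => hts hy
  choose! g hg using hts'
  refine ⟨(fun y => (star T : H →L[ℂ] H) (g y)) '' t, htf.image _, ?_⟩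
  rintro _ ⟨x, hx, rfl⟩
  obtain ⟨y, hy, hxy⟩ := Set.mem_iUnion₂.1 (htc ⟨x, hx, rfl⟩)
  obtain ⟨hgb, hgy⟩ := hg y hy
  refine Set.mem_iUnion₂.2 ⟨_, ⟨y, hy, rfl⟩, ?_⟩
  rw [mem_ball_zero_iff] at hx hgb
  have h1 : ‖T ((star T : H →L[ℂ] H) (x - g y))‖ < ε ^ 2 / 2 := by
    rw [← hgy] at hxy
    simpa [dist_eq_norm] using hxy
  have h2 : ‖(star T : H →L[ℂ] H) (x - g y)‖ ^ 2 ≤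
      ‖T ((star T : H →L[ℂ] H) (x - g y))‖ * ‖x - g y‖ := by
    rw [← inner_self_eq_norm_sq (𝕜 := ℂ)]
    conv_lhs => rw [ContinuousLinearMap.star_eq_adjoint, ContinuousLinearMap.adjoint_inner_right]
    exact (RCLike.re_le_norm _).trans (norm_inner_le_norm _ _)
  have h3 : ‖x - g y‖ ≤ 2 := (norm_sub_le _ _).trans (by linarith)
  have h4 : ‖(star T : H →L[ℂ] H) (x - g y)‖ < ε := by
    refine lt_of_pow_lt_pow_left₀ 2 hε.le ?_
    nlinarith [norm_nonneg (T ((star T : H →L[ℂ] H) (x - g y)))]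
  rw [Metric.mem_ball, dist_eq_norm]
  simpa using h4

variable (H)

/-- The ideal `K(H)` of compact operators in the algebra `B(H)` of bounded operators. -/
def compactIdeal : Ideal (H →L[ℂ] H) where
  carrier := {a | IsCompactOperator a}
  add_mem' ha hb := ha.add hb
  zero_mem' := isCompactOperator_zero
  smul_mem' c _ ha := ha.clm_comp c

instance : (compactIdeal H).IsTwoSided where
  mul_mem_of_left b ha := IsCompactOperator.comp_clm ha b

/-- The Calkin algebra `C(H) = B(H) / K(H)`: its ring, algebra and quotient-norm structures are
those of the quotient by a two-sided ideal; the involution is defined below. -/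
abbrev Calkin : Type _ := (H →L[ℂ] H) ⧸ compactIdeal H

variable {H}

/-- The quotient map `π : B(H) → C(H)`. -/
def toCalkin : (H →L[ℂ] H) →ₐ[ℂ] Calkin H := Ideal.Quotient.mkₐ ℂ (compactIdeal H)

theorem toCalkin_surjective : Function.Surjective (toCalkin (H := H)) :=
  Ideal.Quotient.mkₐ_surjective ℂ _

theorem toCalkin_eq_iff {a b : H →L[ℂ] H} :
    toCalkin a = toCalkin b ↔ IsCompactOperator (a - b : H →L[ℂ] H) :=
  Ideal.Quotient.eq

/-- The involution of the Calkin algebra, `π(a)* = π(a*)`. -/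
instance : Star (Calkin H) where
  star := Quotient.map' star fun a b hab => by
    rw [Submodule.quotientRel_def] at hab ⊢
    rw [← star_sub]
    exact isCompactOperator_star hab

theorem star_toCalkin (a : H →L[ℂ] H) : star (toCalkin a) = toCalkin (star a) := rfl

instance : StarRing (Calkin H) where
  star_involutive x := by
    obtain ⟨a, rfl⟩ := toCalkin_surjective x
    rw [star_toCalkin, star_toCalkin, star_star]
  star_mul x y := by
    obtain ⟨a, rfl⟩ := toCalkin_surjective x
    obtain ⟨b, rfl⟩ := toCalkin_surjective y
    rw [← map_mul, star_toCalkin, star_toCalkin, star_toCalkin, star_mul, map_mul]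
  star_add x y := by
    obtain ⟨a, rfl⟩ := toCalkin_surjective x
    obtain ⟨b, rfl⟩ := toCalkin_surjective y
    rw [← map_add, star_toCalkin, star_toCalkin, star_toCalkin, star_add, map_add]

instance : StarModule ℂ (Calkin H) where
  star_smul c x := by
    obtain ⟨a, rfl⟩ := toCalkin_surjective x
    rw [← map_smul, star_toCalkin, star_toCalkin, star_smul, map_smul]

/-- A *-automorphism of the Calkin algebra is inner if it is conjugation `x ↦ u x u*` by a unitary
`u` of the Calkin algebra. -/
def IsInner (Φ : Calkin H ≃⋆ₐ[ℂ] Calkin H) : Prop :=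
  ∃ u : unitary (Calkin H), Φ = Unitary.conjStarAlgAut ℂ (Calkin H) u

/-- A *-automorphism of the Calkin algebra is outer if it is not inner. -/
def IsOuter (Φ : Calkin H ≃⋆ₐ[ℂ] Calkin H) : Prop := ¬ IsInner Φ

/-- The restriction of `Φ` to the subset `X` of the Calkin algebra is inner if it coincides with
the restriction of some inner automorphism. -/
def IsInnerOn (Φ : Calkin H ≃⋆ₐ[ℂ] Calkin H) (X : Set (Calkin H)) : Prop :=
  ∃ Φ' : Calkin H ≃⋆ₐ[ℂ] Calkin H, IsInner Φ' ∧ Set.EqOn Φ Φ' X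

end Calkin

/-! ### Interval partitions -/

/-- A partition of `ℕ` into consecutive nonempty finite intervals
`E_n = [cut n, cut (n + 1))`, given by its endpoints. -/
structure IntervalPartition where
  cut : ℕ → ℕ
  cut_zero : cut 0 = 0
  strictMono : StrictMono cut

namespace IntervalPartition

/-- The interval `E_n`. -/
def block (E : IntervalPartition) (n : ℕ) : Set ℕ := Set.Ico (E.cut n) (E.cut (n + 1))

/-- `E ≤* F`: for all but finitely many `i` there is `j` with
`E_i ∪ E_{i+1} ⊆ F_j ∪ F_{j+1}`. -/
def AlmostLE (E F : IntervalPartition) : Prop :=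
  ∀ᶠ i in Filter.atTop, ∃ j, E.block i ∪ E.block (i + 1) ⊆ F.block j ∪ F.block (j + 1)

/-- The partition into singletons, `E_n = {n}`. -/
def singletons : IntervalPartition := ⟨id, rfl, strictMono_id⟩

/-- The partition with entries `E_{2n} ∪ E_{2n+1}`. -/
def even (E : IntervalPartition) : IntervalPartition where
  cut n := E.cut (2 * n)
  cut_zero := E.cut_zero
  strictMono _ _ h := E.strictMono (by omega)

/-- The partition with entries `E_0` and `E_{2n-1} ∪ E_{2n}` for `n ≥ 1` (the truncated
subtraction gives the endpoint `cut 0 = 0` at `n = 0`). -/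
def odd (E : IntervalPartition) : IntervalPartition where
  cut n := E.cut (2 * n - 1)
  cut_zero := E.cut_zero
  strictMono _ _ h := E.strictMono (by omega)

end IntervalPartition

/-! ### FDD von Neumann algebras and diagonal unitaries -/

section FDD

variable {H : Type*} [NormedAddCommGroup H] [InnerProductSpace ℂ H] [CompleteSpace H]
  (e : HilbertBasis ℕ ℂ H)

/-- The FDD von Neumann algebra `D[E]`: all bounded operators for which each
`span {e_i | i ∈ E_n}` is invariant. -/
def fdd (E : IntervalPartition) : Set (H →L[ℂ] H) :=
  {a | ∀ n, ∀ x ∈ Submodule.span ℂ (e '' E.block n), a x ∈ Submodule.span ℂ (e '' E.block n)}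

/-- The standard atomic masa: all bounded operators diagonalized by the basis `(e_n)`, that is,
`D[E]` for the partition into singletons. -/
def atomicMasa : Set (H →L[ℂ] H) := fdd e IntervalPartition.singletons

/-- `F[E] = D[E^even] ∪ D[E^odd]`. -/
def evenOdd (E : IntervalPartition) : Set (H →L[ℂ] H) := fdd e E.even ∪ fdd e E.odd

/-- The rotated orthonormal basis `(α(n) e_n)`. -/
def rotatedBasis (α : ℕ → Circle) : HilbertBasis ℕ ℂ H :=
  HilbertBasis.mk (v := fun n => (α n : ℂ) • e n)
    (by
      rw [orthonormal_iff_ite]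
      intro i j
      rw [inner_smul_left, inner_smul_right, orthonormal_iff_ite.1 e.orthonormal i j]
      split_ifs with h
      · subst h
        rw [mul_one, ← Circle.coe_inv_eq_conj, ← Circle.coe_mul, inv_mul_cancel, Circle.coe_one]
      · simp)
    (by
      rw [← e.dense_span]
      refine Submodule.topologicalClosure_mono (Submodule.span_le.2 ?_)
      rintro _ ⟨n, rfl⟩
      have h := Submodule.smul_mem _ ((α n : ℂ)⁻¹)
        (Submodule.subset_span (R := ℂ) (Set.mem_range_self (f := fun n => (α n : ℂ) • e n) n))
      simpa using h)

/-- The diagonal unitary `u_α`, which sends `e_n` to `α(n) e_n`. -/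
def diagonalUnitary (α : ℕ → Circle) : unitary (H →L[ℂ] H) :=
  Unitary.linearIsometryEquiv.symm (e.repr.trans (rotatedBasis e α).repr.symm)

theorem diagonalUnitary_apply (α : ℕ → Circle) (n : ℕ) :
    (diagonalUnitary e α : H →L[ℂ] H) (e n) = (α n : ℂ) • e n := by
  classical
  simp [diagonalUnitary, rotatedBasis, HilbertBasis.repr_self, HilbertBasis.repr_symm_single]

/-- The conjugation `Ψ_α(a) = u_α a u_α*`. -/
def conjDiag (α : ℕ → Circle) (a : H →L[ℂ] H) : H →L[ℂ] H :=
  (diagonalUnitary e α : H →L[ℂ] H) * a * star (diagonalUnitary e α : H →L[ℂ] H)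

/-- `Ψ_α` and `Ψ_β` agree modulo compacts on `D`: `Ψ_α(a) - Ψ_β(a)` is compact for all `a ∈ D`. -/
def AgreeModCompacts (α β : ℕ → Circle) (D : Set (H →L[ℂ] H)) : Prop :=
  ∀ a ∈ D, IsCompactOperator (conjDiag e α a - conjDiag e β a : H →L[ℂ] H)

/-- `Ψ_α` is a representation of `Φ` on `D`: `Φ(π(a)) = π(Ψ_α(a))` for all `a ∈ D`. -/
def RepresentsOn (Φ : Calkin H ≃⋆ₐ[ℂ] Calkin H) (α : ℕ → Circle) (D : Set (H →L[ℂ] H)) : Prop :=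
  ∀ a ∈ D, Φ (toCalkin a) = toCalkin (conjDiag e α a)

end FDD

/-- The index set `ω₁`: all countable ordinals, with their natural order. -/
abbrev Omega1 : Type _ := Set.Iio (Ordinal.omega.{0} 1)

end CalkinCH

end

noncomputable section

set_option linter.unusedSectionVars false

namespace CalkinCH

namespace IntervalPartition

/-! ### Combinatorics of interval partitions -/

variable {E F G : IntervalPartition}

theorem ext' (h : ∀ n, E.cut n = F.cut n) : E = F := by
  cases E; cases F
  simp only [mk.injEq]
  exact funext h

theorem mem_block {n i : ℕ} : i ∈ E.block n ↔ E.cut n ≤ i ∧ i < E.cut (n + 1) := Iff.rfl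

/-- The union `E_n ∪ E_{n+1}` of two adjacent intervals. -/
def pair (E : IntervalPartition) (n : ℕ) : Set ℕ := E.block n ∪ E.block (n + 1)

theorem mem_pair {n i : ℕ} : i ∈ E.pair n ↔ E.cut n ≤ i ∧ i < E.cut (n + 2) := by
  have h1 := E.strictMono (Nat.lt_succ_self n)
  have h2 := E.strictMono (Nat.lt_succ_self (n + 1))
  simp only [pair, Set.mem_union, mem_block, Nat.succ_eq_add_one, add_assoc,
    Nat.reduceAdd] at *
  omega

/-- The index of the interval that contains `i`. -/
def index (E : IntervalPartition) (i : ℕ) : ℕ := Nat.findGreatest (fun n => E.cut n ≤ i) i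

theorem mem_block_index (i : ℕ) : i ∈ E.block (E.index i) := by
  refine mem_block.2 ⟨Nat.findGreatest_spec (P := fun n => E.cut n ≤ i) (Nat.zero_le i)
    (by rw [E.cut_zero]; exact Nat.zero_le i), ?_⟩
  by_contra! h
  have h1 : E.index i + 1 ≤ i := (E.strictMono.le_apply).trans h
  exact absurd (Nat.le_findGreatest (P := fun n => E.cut n ≤ i) h1 h) (by simp [index])

theorem index_eq {n i : ℕ} (h : i ∈ E.block n) : E.index i = n := by
  have h1 := mem_block.1 (E.mem_block_index i)
  have h2 := mem_block.1 h
  have h3 := E.strictMono.lt_iff_lt.1 (h1.1.trans_lt h2.2)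
  have h4 := E.strictMono.lt_iff_lt.1 (h2.1.trans_lt h1.2)
  omega

theorem mem_block_iff {n i : ℕ} : i ∈ E.block n ↔ E.index i = n :=
  ⟨index_eq, fun h => h ▸ E.mem_block_index i⟩

theorem index_cut (n : ℕ) : E.index (E.cut n) = n :=
  index_eq (mem_block.2 ⟨le_rfl, E.strictMono n.lt_succ_self⟩)

theorem le_index {n i : ℕ} (h : E.cut n ≤ i) : n ≤ E.index i := by
  have := E.strictMono.lt_iff_lt.1 (h.trans_lt (mem_block.1 (E.mem_block_index i)).2)
  omega

theorem index_even (i : ℕ) : E.even.index i = E.index i / 2 := by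
  refine index_eq (mem_block.2 ?_)
  have h := mem_block.1 (E.mem_block_index i)
  exact ⟨(E.strictMono.monotone (by omega)).trans h.1,
    h.2.trans_le (E.strictMono.monotone (by omega))⟩

theorem index_odd (i : ℕ) : E.odd.index i = (E.index i + 1) / 2 := by
  refine index_eq (mem_block.2 ?_)
  have h := mem_block.1 (E.mem_block_index i)
  exact ⟨(E.strictMono.monotone (by omega)).trans h.1,
    h.2.trans_le (E.strictMono.monotone (by omega))⟩

theorem AlmostLE.refl (E : IntervalPartition) : E.AlmostLE E :=
  Filter.Eventually.of_forall fun i => ⟨i, subset_rfl⟩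

theorem AlmostLE.trans (h₁ : E.AlmostLE F) (h₂ : F.AlmostLE G) : E.AlmostLE G := by
  obtain ⟨N, hN⟩ := Filter.eventually_atTop.1 h₂
  filter_upwards [h₁, Filter.eventually_ge_atTop (F.cut (N + 2))] with i ⟨j, hj⟩ hi
  have h3 : E.cut i ∈ F.pair j := hj (mem_pair.2 ⟨le_rfl, E.strictMono (by omega)⟩)
  have h4 : F.cut (N + 2) < F.cut (j + 2) :=
    (hi.trans E.strictMono.le_apply).trans_lt (mem_pair.1 h3).2
  have h5 := F.strictMono.lt_iff_lt.1 h4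
  obtain ⟨k, hk⟩ := hN j (by omega)
  exact ⟨k, hj.trans hk⟩

/-- `E` is `≤*` every partition into unions of its intervals. -/
theorem AlmostLE.of_cut_comp {k : ℕ → ℕ} (hk : ∀ m, F.cut m = E.cut (k m)) : E.AlmostLE F := by
  have hk' : StrictMono k := fun a b hab => by
    have := F.strictMono hab
    rw [hk, hk] at this
    exact E.strictMono.lt_iff_lt.1 this
  refine Filter.Eventually.of_forall fun i => ?_
  have h := mem_block.1 (F.mem_block_index (E.cut i))
  refine ⟨F.index (E.cut i), fun x hx => mem_pair.2 ?_⟩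
  have hx : E.cut i ≤ x ∧ x < E.cut (i + 2) := mem_pair.1 hx
  generalize F.index (E.cut i) = j at *
  refine ⟨h.1.trans hx.1, hx.2.trans_le ?_⟩
  rw [hk] at h ⊢
  rw [hk] at h
  refine E.strictMono.monotone ?_
  have h1 := E.strictMono.lt_iff_lt.1 h.2
  have h2 := hk' (Nat.lt_succ_self (j + 1))
  simp only [Nat.succ_eq_add_one, add_assoc, Nat.reduceAdd] at h2
  omega

/-- The interval partition whose endpoints are obtained by iterating `c n ↦ max (c n + 1) (f n (c n))`. -/
def ofStep (f : ℕ → ℕ → ℕ) : IntervalPartition where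
  cut n := Nat.rec 0 (fun n c => max (c + 1) (f n c)) n
  cut_zero := rfl
  strictMono := strictMono_nat_of_lt_succ fun _ => lt_of_lt_of_le (Nat.lt_succ_self _)
    (le_max_left _ _)

theorem le_cut_ofStep (f : ℕ → ℕ → ℕ) (n : ℕ) :
    f n ((ofStep f).cut n) ≤ (ofStep f).cut (n + 1) :=
  le_max_right _ _

/-- Countably many interval partitions have a common upper bound. -/
theorem exists_upper_bound (G : ℕ → IntervalPartition) :
    ∃ E : IntervalPartition, ∀ n, (G n).AlmostLE E := by
  let f : ℕ → ℕ → ℕ := fun n c => ∑ l ∈ Finset.range (n + 1), (G l).cut (c + 1)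
  refine ⟨ofStep f, fun l => ?_⟩
  set E := ofStep f
  filter_upwards [Filter.eventually_ge_atTop (E.cut l)] with i hi
  have h := mem_block.1 (E.mem_block_index ((G l).cut i))
  have hl : l ≤ E.index ((G l).cut i) := le_index (hi.trans (G l).strictMono.le_apply)
  refine ⟨E.index ((G l).cut i), fun x hx => mem_pair.2 ?_⟩
  have hx : (G l).cut i ≤ x ∧ x < (G l).cut (i + 2) := mem_pair.1 hx
  generalize E.index ((G l).cut i) = j at *
  refine ⟨h.1.trans hx.1, hx.2.trans_le ?_⟩
  have h1 : (G l).cut (E.cut (j + 1) + 1) ≤ f (j + 1) (E.cut (j + 1)) :=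
    Finset.single_le_sum (f := fun l => (G l).cut (E.cut (j + 1) + 1)) (fun _ _ => Nat.zero_le _)
      (Finset.mem_range.2 (by omega))
  refine le_trans ?_ (h1.trans (le_cut_ofStep f (j + 1)))
  refine (G l).strictMono.monotone ?_
  have := ((G l).strictMono.le_apply (x := i)).trans_lt h.2
  omega

end IntervalPartition

open IntervalPartition

/-! ### Slowly varying circle-valued sequences -/

/-- The oscillation of `γ` on the `n`-th interval of `E` tends to zero. -/
def SlowOnBlocks (E : IntervalPartition) (γ : ℕ → Circle) : Prop :=
  ∀ ε > 0, ∃ N, ∀ n, ∀ i ∈ E.block n, ∀ j ∈ E.block n, N ≤ i → N ≤ j → ‖(γ i : ℂ) - γ j‖ < ε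

/-- The oscillation of `γ` on the union of the `n`-th and the `n+1`-st interval of `E` tends to
zero. -/
def Slow (E : IntervalPartition) (γ : ℕ → Circle) : Prop :=
  ∀ ε > 0, ∃ N, ∀ n, ∀ i ∈ E.pair n, ∀ j ∈ E.pair n, N ≤ i → N ≤ j → ‖(γ i : ℂ) - γ j‖ < ε

theorem norm_mul_sub_mul_le (a b c d : Circle) :
    ‖((a * b : Circle) : ℂ) - (c * d : Circle)‖ ≤ ‖(a : ℂ) - c‖ + ‖(b : ℂ) - d‖ := by
  have h : ((a * b : Circle) : ℂ) - (c * d : Circle) = ((a : ℂ) - c) * b + c * ((b : ℂ) - d) := by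
    push_cast; ring
  rw [h]
  refine (norm_add_le _ _).trans ?_
  simp [Circle.norm_coe]

theorem norm_inv_sub_inv (a b : Circle) :
    ‖((a⁻¹ : Circle) : ℂ) - (b⁻¹ : Circle)‖ = ‖(a : ℂ) - b‖ := by
  rw [Circle.coe_inv_eq_conj, Circle.coe_inv_eq_conj, ← map_sub, RCLike.norm_conj]

variable {E F : IntervalPartition} {γ δ : ℕ → Circle}

theorem Slow.mul (hγ : Slow E γ) (hδ : Slow E δ) : Slow E (γ * δ) := by
  intro ε hε
  obtain ⟨N, hN⟩ := hγ (ε / 2) (half_pos hε)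
  obtain ⟨M, hM⟩ := hδ (ε / 2) (half_pos hε)
  refine ⟨max N M, fun n i hi j hj h1 h2 => ?_⟩
  have h3 := hN n i hi j hj (le_of_max_le_left h1) (le_of_max_le_left h2)
  have h4 := hM n i hi j hj (le_of_max_le_right h1) (le_of_max_le_right h2)
  exact (norm_mul_sub_mul_le _ _ _ _).trans_lt (by linarith)

theorem Slow.inv (hγ : Slow E γ) : Slow E γ⁻¹ := by
  intro ε hε
  obtain ⟨N, hN⟩ := hγ ε hε
  refine ⟨N, fun n i hi j hj h1 h2 => ?_⟩
  simpa only [Pi.inv_apply, norm_inv_sub_inv] using hN n i hi j hj h1 h2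

theorem Slow.one : Slow E 1 := fun ε hε => ⟨0, fun n i _ j _ _ _ => by simpa using hε⟩

theorem Slow.of_eventually_const {c : Circle} {N : ℕ} (h : ∀ i, N ≤ i → γ i = c) : Slow E γ :=
  fun ε hε => ⟨N, fun n i _ j _ hi hj => by rw [h i hi, h j hj]; simpa using hε⟩

theorem Slow.mono (hγ : Slow F γ) (h : E.AlmostLE F) : Slow E γ := by
  intro ε hε
  obtain ⟨N, hN⟩ := hγ ε hε
  obtain ⟨m, hm⟩ := Filter.eventually_atTop.1 h
  refine ⟨max N (E.cut (m + 2)), fun n i hi j hj h1 h2 => ?_⟩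
  have h3 := (le_of_max_le_right h1).trans_lt (mem_pair.1 hi).2
  have h4 := E.strictMono.lt_iff_lt.1 h3
  obtain ⟨k, hk⟩ := hm n (by omega)
  exact hN k i (hk hi) j (hk hj) (le_of_max_le_left h1) (le_of_max_le_left h2)

theorem Slow.slowOnBlocks_self (hγ : Slow E γ) : SlowOnBlocks E γ := by
  intro ε hε
  obtain ⟨N, hN⟩ := hγ ε hε
  exact ⟨N, fun n i hi j hj => hN n i (Or.inl hi) j (Or.inl hj)⟩

theorem Slow.slowOnBlocks_even (hγ : Slow E γ) : SlowOnBlocks E.even γ := by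
  intro ε hε
  obtain ⟨N, hN⟩ := hγ ε hε
  exact ⟨N, fun n i hi j hj => hN (2 * n) i (mem_pair.2 hi) j (mem_pair.2 hj)⟩

theorem Slow.slowOnBlocks_odd (hγ : Slow E γ) : SlowOnBlocks E.odd γ := by
  intro ε hε
  obtain ⟨N, hN⟩ := hγ ε hε
  have key : ∀ n, ∀ i ∈ E.odd.block n, i ∈ E.pair (2 * n - 1) := fun n i hi => by
    have hi := mem_block.1 hi
    exact mem_pair.2 ⟨hi.1, hi.2.trans_le (E.strictMono.monotone (by omega))⟩
  exact ⟨N, fun n i hi j hj => hN (2 * n - 1) i (key n i hi) j (key n j hj)⟩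

/-- A sequence that is slowly varying along finitely many partitions can be made constant on an
initial segment, with small oscillation everywhere. -/
theorem Slow.exists_truncation {G : ℕ → IntervalPartition} {n : ℕ}
    (hδ : ∀ l ≤ n, Slow (G l) δ) {ε : ℝ} (hε : 0 < ε) (K : ℕ) :
    ∃ δ' : ℕ → Circle, (∀ i ≤ K, δ' i = 1) ∧
      (∃ N, ∃ c : Circle, ∀ i, N ≤ i → δ' i = δ i * c) ∧
      ∀ l ≤ n, ∀ m, ∀ i ∈ (G l).pair m, ∀ j ∈ (G l).pair m, ‖(δ' i : ℂ) - δ' j‖ < ε := by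
  have h : ∀ l, ∃ N, l ≤ n → ∀ m, ∀ i ∈ (G l).pair m, ∀ j ∈ (G l).pair m, N ≤ i → N ≤ j →
      ‖(δ i : ℂ) - δ j‖ < ε := fun l => by
    by_cases hl : l ≤ n
    · obtain ⟨N, hN⟩ := hδ l hl ε hε
      exact ⟨N, fun _ => hN⟩
    · exact ⟨0, fun h => absurd h hl⟩
  choose N hN using h
  set M := K + ∑ l ∈ Finset.range (n + 1), N l
  have hM : ∀ l ≤ n, N l ≤ M := fun l hl => le_add_left
    (Finset.single_le_sum (f := N) (fun _ _ => Nat.zero_le _) (Finset.mem_range.2 (by omega)))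
  have hKM : K ≤ M := Nat.le_add_right _ _
  refine ⟨fun i => δ (max i M) * (δ M)⁻¹, fun i hi => ?_, ⟨M, (δ M)⁻¹, fun i hi => ?_⟩, ?_⟩
  · simp only [max_eq_right (hi.trans hKM), mul_inv_cancel]
  · simp only [max_eq_left hi]
  · intro l hl m i hi j hj
    have h1 : ((δ (max i M) * (δ M)⁻¹ : Circle) : ℂ) - (δ (max j M) * (δ M)⁻¹ : Circle) =
        ((δ (max i M) : ℂ) - δ (max j M)) * ((δ M)⁻¹ : Circle) := by push_cast; ring
    rw [h1, norm_mul, Circle.norm_coe, mul_one]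
    by_cases h2 : i ≤ M ∧ j ≤ M
    · rw [max_eq_right h2.1, max_eq_right h2.2]
      simpa using hε
    · have hi' := mem_pair.1 hi
      have hj' := mem_pair.1 hj
      refine hN l hl m _ (mem_pair.2 ⟨?_, ?_⟩) _ (mem_pair.2 ⟨?_, ?_⟩)
        ((hM l hl).trans (le_max_right _ _)) ((hM l hl).trans (le_max_right _ _)) <;> omega

/-- A coherent sequence of circle-valued sequences has an upper bound. -/
theorem exists_amalgamation {G : ℕ → IntervalPartition} {β : ℕ → ℕ → Circle}
    (hG : ∀ l n, l ≤ n → (G l).AlmostLE (G n))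
    (hβ : ∀ l n, l ≤ n → Slow (G l) ((β l)⁻¹ * β n)) :
    ∃ γ : ℕ → Circle, ∀ l, Slow (G l) ((β l)⁻¹ * γ) := by
  have step : ∀ n, ∃ δ' : ℕ → Circle, (∀ i ≤ n, δ' i = 1) ∧
      (∃ N, ∃ c : Circle, ∀ i, N ≤ i → δ' i = ((β n)⁻¹ * β (n + 1)) i * c) ∧
      ∀ l ≤ n, ∀ m, ∀ i ∈ (G l).pair m, ∀ j ∈ (G l).pair m,
        ‖(δ' i : ℂ) - δ' j‖ < (1 / 2) ^ n := fun n =>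
    Slow.exists_truncation (fun l hl => (hβ n (n + 1) n.le_succ).mono (hG l n hl))
      (by positivity) n
  choose δ h1 h2 h3 using step
  let T : ℕ → ℕ → Circle := fun n => β 0 * ∏ m ∈ Finset.range n, δ m
  have hT : ∀ n, T (n + 1) = T n * δ n := fun n => by
    simp only [T, Finset.prod_range_succ, mul_assoc]
  have hstab : ∀ i d, T (i + d) i = T i i := fun i d => by
    induction d with
    | zero => rfl
    | succ d ih => rw [← add_assoc, hT, Pi.mul_apply, ih, h1 _ i (by omega), mul_one]
  have hTβ : ∀ n, ∃ N, ∃ c : Circle, ∀ i, N ≤ i → T n i = β n i * c := fun n => by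
    induction n with
    | zero => exact ⟨0, 1, fun i _ => by simp [T]⟩
    | succ n ih =>
      obtain ⟨N, c, hc⟩ := ih
      obtain ⟨M, d, hd⟩ := h2 n
      refine ⟨max N M, c * d, fun i hi => ?_⟩
      rw [hT, Pi.mul_apply, hc i (le_of_max_le_left hi), hd i (le_of_max_le_right hi)]
      simp only [Pi.mul_apply, Pi.inv_apply]
      rw [mul_mul_mul_comm, mul_inv_cancel_left]
  have htail : ∀ l M, l ≤ M → ∀ m, ∀ i ∈ (G l).pair m, ∀ j ∈ (G l).pair m, ∀ d,
      ‖(((T M)⁻¹ * T (M + d)) i : ℂ) - ((T M)⁻¹ * T (M + d)) j‖ ≤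
        2 * (1 / 2) ^ M - 2 * (1 / 2) ^ (M + d) := by
    intro l M hl m i hi j hj d
    induction d with
    | zero => simp
    | succ d ih =>
      have h4 := (h3 (M + d) l (by omega) m i hi j hj).le
      rw [← add_assoc, hT, ← mul_assoc]
      refine (norm_mul_sub_mul_le _ _ _ _).trans ?_
      rw [pow_succ (1 / 2 : ℝ) (M + d)]
      linarith
  refine ⟨fun i => T i i, fun l ε hε => ?_⟩
  obtain ⟨k, hk⟩ := exists_pow_lt_of_lt_one (show 0 < ε / 4 by positivity)
    (show (1 / 2 : ℝ) < 1 by norm_num)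
  set M := k + l
  have hM : ((1 / 2 : ℝ)) ^ M < ε / 4 :=
    (pow_le_pow_of_le_one (by norm_num) (by norm_num) (Nat.le_add_right k l)).trans_lt hk
  have hS : Slow (G l) ((β l)⁻¹ * T M) := by
    obtain ⟨N, c, hc⟩ := hTβ M
    have h5 : Slow (G l) ((β M)⁻¹ * T M) := Slow.of_eventually_const (c := c) (N := N)
      fun i hi => by rw [Pi.mul_apply, Pi.inv_apply, hc i hi, inv_mul_cancel_left]
    have h6 := (hβ l M (Nat.le_add_left l k)).mul h5
    rwa [mul_assoc, mul_inv_cancel_left] at h6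
  obtain ⟨N, hN⟩ := hS (ε / 2) (half_pos hε)
  refine ⟨N, fun n i hi j hj hNi hNj => ?_⟩
  have e1 : ∀ i' d, i' ≤ M + d → T i' i' = T (M + d) i' := fun i' d hd => by
    obtain ⟨x, hx⟩ := Nat.exists_eq_add_of_le hd
    rw [hx, hstab]
  have e2 : ∀ i', i' ≤ M + (i + j) → ((β l)⁻¹ * fun i => T i i) i' =
      ((β l)⁻¹ * T M) i' * ((T M)⁻¹ * T (M + (i + j))) i' := fun i' hi' => by
    simp only [Pi.mul_apply, Pi.inv_apply]
    rw [e1 i' _ hi', mul_assoc, mul_inv_cancel_left]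
  rw [e2 i (by omega), e2 j (by omega)]
  refine (norm_mul_sub_mul_le _ _ _ _).trans_lt ?_
  have h7 := hN n i hi j hj hNi hNj
  have h8 := htail l M (Nat.le_add_left l k) n i hi j hj (i + j)
  have h9 : (0 : ℝ) < (1 / 2) ^ (M + (i + j)) := by positivity
  linarith

theorem norm_circleExp_sub_circleExp_le (s t : ℝ) :
    ‖(Circle.exp s : ℂ) - Circle.exp t‖ ≤ |s - t| := by
  have h : (Circle.exp s : ℂ) - Circle.exp t =
      Circle.exp t * (Complex.exp (Complex.I * (s - t : ℝ)) - 1) := by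
    rw [Circle.coe_exp, Circle.coe_exp, mul_sub, ← Complex.exp_add, mul_one]
    congr 2
    push_cast
    ring
  rw [h, norm_mul, Circle.norm_coe, one_mul]
  exact Real.norm_exp_I_mul_ofReal_sub_one_le

/-- A slowly varying sequence that oscillates between `1` and `-1`. -/
theorem exists_slow_oscillating (E : IntervalPartition) :
    ∃ (γ : ℕ → Circle) (F : IntervalPartition), Slow E γ ∧ E.AlmostLE F ∧
      ∀ m, γ (F.cut m) = (-1) ^ m := by
  let F : IntervalPartition := ⟨fun m => E.cut (m ^ 2), by simpa using E.cut_zero,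
    fun a b hab => E.strictMono (Nat.pow_lt_pow_left hab two_ne_zero)⟩
  refine ⟨fun i => Circle.exp (Real.pi * √(E.index i)), F, ?_, AlmostLE.of_cut_comp (fun _ => rfl),
    fun m => ?_⟩
  · intro ε hε
    obtain ⟨K, hK⟩ := exists_nat_gt ((Real.pi / ε) ^ 2)
    refine ⟨E.cut (K + 1), fun n i hi j hj h1 h2 => ?_⟩
    refine (norm_circleExp_sub_circleExp_le _ _).trans_lt ?_
    have hπ := Real.pi_pos
    have hn : ∀ i ∈ E.pair n, E.index i = n ∨ E.index i = n + 1 := fun i hi =>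
      hi.imp index_eq index_eq
    have h3 := le_index h1
    have h4 := le_index h2
    have hKn : (K : ℝ) ≤ n := by
      have := hn i hi
      exact_mod_cast (by omega : K ≤ n)
    have hs : Real.pi / ε < √n := Real.lt_sqrt_of_sq_lt (hK.trans_le hKn)
    have hs0 : 0 < √(n : ℝ) := lt_trans (by positivity) hs
    have hs1 : √(n : ℝ) ≤ √((n + 1 : ℕ) : ℝ) := Real.sqrt_le_sqrt (by push_cast; linarith)
    have hd : √((n + 1 : ℕ) : ℝ) - √(n : ℝ) < ε / Real.pi := by
      have e1 := Real.sq_sqrt (Nat.cast_nonneg (α := ℝ) n)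
      have e2 := Real.sq_sqrt (Nat.cast_nonneg (α := ℝ) (n + 1))
      push_cast at e2 hs1 ⊢
      rw [lt_div_iff₀ hπ]
      rw [div_lt_iff₀ hε] at hs
      by_contra! hcon
      have : (√((n : ℝ) + 1) - √n) * (√((n : ℝ) + 1) + √n) = 1 := by
        linear_combination e2 - e1
      nlinarith
    have hfin : |√(E.index i : ℝ) - √(E.index j : ℝ)| < ε / Real.pi := by
      have hεπ : 0 < ε / Real.pi := by positivity
      rcases hn i hi with h | h <;> rcases hn j hj with h' | h' <;> rw [h, h', abs_lt] <;>
        constructor <;> linarith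
    rw [← mul_sub, abs_mul, abs_of_pos hπ]
    rwa [lt_div_iff₀' hπ] at hfin
  · have hF : F.cut m = E.cut (m ^ 2) := rfl
    have h1 : Real.pi * √((m ^ 2 : ℕ) : ℝ) = m * Real.pi := by
      push_cast
      rw [Real.sqrt_sq (Nat.cast_nonneg m), mul_comm]
    show Circle.exp (Real.pi * √(E.index (F.cut m))) = _
    rw [hF, index_cut, h1, Circle.exp_natCast_mul]
    congr 1
    exact Circle.ext (by simp [Circle.coe_exp])

end CalkinCH

namespace CalkinCH

open IntervalPartition InnerProductSpace

variable {H : Type*} [NormedAddCommGroup H] [InnerProductSpace ℂ H] [CompleteSpace H]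
  (e : HilbertBasis ℕ ℂ H)

/-! ### Matrix coefficients -/

theorem inner_basis (i j : ℕ) : inner ℂ (e i) (e j) = if i = j then 1 else 0 :=
  orthonormal_iff_ite.1 e.orthonormal i j

theorem ext_inner_basis {x y : H} (h : ∀ i, inner ℂ (e i) x = inner ℂ (e i) y) : x = y := by
  apply e.repr.injective
  ext i
  simpa only [e.repr_apply_apply] using h i

/-- The matrix coefficient `a ↦ ⟨e_i, a e_j⟩`. -/
def coef (i j : ℕ) : (H →L[ℂ] H) →L[ℂ] ℂ :=
  (innerSL ℂ (e i)).comp (ContinuousLinearMap.apply ℂ H (e j))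

theorem coef_apply (i j : ℕ) (a : H →L[ℂ] H) : coef e i j a = inner ℂ (e i) (a (e j)) := rfl

theorem ext_basis {a b : H →L[ℂ] H} (h : ∀ j, a (e j) = b (e j)) : a = b := by
  refine ContinuousLinearMap.ext_on (s := Set.range e) ?_ ?_
  · rw [Submodule.dense_iff_topologicalClosure_eq_top]
    exact e.dense_span
  · rintro _ ⟨j, rfl⟩
    exact h j

theorem ext_coef {a b : H →L[ℂ] H} (h : ∀ i j, coef e i j a = coef e i j b) : a = b :=
  ext_basis e fun j => ext_inner_basis e fun i => h i j

variable {e}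

theorem mem_span_block_iff {E : IntervalPartition} {n : ℕ} {x : H} :
    x ∈ Submodule.span ℂ (e '' E.block n) ↔ ∀ i ∉ E.block n, inner ℂ (e i) x = 0 := by
  constructor
  · intro hx i hi
    induction hx using Submodule.span_induction with
    | mem x hx =>
      obtain ⟨j, hj, rfl⟩ := hx
      rw [inner_basis, if_neg (fun h : i = j => hi (h ▸ hj))]
    | zero => exact inner_zero_right _
    | add x y _ _ hx hy => rw [inner_add_right, hx, hy, add_zero]
    | smul c x _ hx => rw [inner_smul_right, hx, mul_zero]
  · intro h
    have h1 : HasSum (fun i => e.repr x i • e i)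
        (∑ i ∈ Finset.Ico (E.cut n) (E.cut (n + 1)), e.repr x i • e i) := by
      refine hasSum_sum_of_ne_finset_zero fun i hi => ?_
      rw [e.repr_apply_apply, h i (fun h' => hi (Finset.mem_Ico.2 h')), zero_smul]
    rw [(e.hasSum_repr x).unique h1]
    exact Submodule.sum_mem _ fun i hi => Submodule.smul_mem _ _
      (Submodule.subset_span ⟨i, Finset.mem_Ico.1 hi, rfl⟩)

theorem mem_fdd_iff {E : IntervalPartition} {a : H →L[ℂ] H} :
    a ∈ fdd e E ↔ ∀ i j, E.index i ≠ E.index j → coef e i j a = 0 := by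
  constructor
  · intro h i j hij
    have h1 := h (E.index j) (e j) (Submodule.subset_span ⟨j, E.mem_block_index j, rfl⟩)
    exact mem_span_block_iff.1 h1 i (fun hi => hij (index_eq hi))
  · intro h n x hx
    induction hx using Submodule.span_induction with
    | mem x hx =>
      obtain ⟨j, hj, rfl⟩ := hx
      refine mem_span_block_iff.2 fun i hi => h i j fun hij => hi ?_
      rw [mem_block_iff, hij, index_eq hj]
    | zero => rw [map_zero]; exact Submodule.zero_mem _
    | add x y _ _ hx hy => rw [map_add]; exact Submodule.add_mem _ hx hy
    | smul c x _ hx => rw [map_smul]; exact Submodule.smul_mem _ _ hx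

variable (e)

/-! ### Diagonal unitaries -/

/-- The diagonal unitary as an operator. -/
def diag (α : ℕ → Circle) : H →L[ℂ] H := diagonalUnitary e α

theorem diag_basis (α : ℕ → Circle) (j : ℕ) : diag e α (e j) = (α j : ℂ) • e j :=
  diagonalUnitary_apply e α j

theorem diag_mul (α β : ℕ → Circle) : diag e (α * β) = diag e α * diag e β :=
  ext_basis e fun j => by
    simp [diag_basis, smul_smul, mul_comm]

theorem diag_one : diag e 1 = 1 := ext_basis e fun j => by simp [diag_basis]

/-- The diagonal unitaries form a group. -/
def diagHom : (ℕ → Circle) →* unitary (H →L[ℂ] H) where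
  toFun := diagonalUnitary e
  map_one' := Subtype.ext (diag_one e)
  map_mul' α β := Subtype.ext (diag_mul e α β)

theorem star_diag (α : ℕ → Circle) : star (diag e α) = diag e α⁻¹ := by
  have h : ((diagHom e α⁻¹ : unitary (H →L[ℂ] H)) : H →L[ℂ] H) = star (diagHom e α) := by
    rw [map_inv, ← Unitary.star_eq_inv, Unitary.coe_star]
  exact h.symm

theorem inner_diag (α : ℕ → Circle) (i : ℕ) (x : H) :
    inner ℂ (e i) (diag e α x) = α i * inner ℂ (e i) x := by
  rw [← ContinuousLinearMap.adjoint_inner_left, ← ContinuousLinearMap.star_eq_adjoint, star_diag,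
    diag_basis, inner_smul_left, ← Circle.coe_inv_eq_conj, Pi.inv_apply, inv_inv]

theorem coef_mul_diag (a : H →L[ℂ] H) (α : ℕ → Circle) (i j : ℕ) :
    coef e i j (a * diag e α) = coef e i j a * α j := by
  simp only [coef_apply, mul_apply_eq_comp, diag_basis, map_smul, inner_smul_right]
  exact mul_comm _ _

theorem coef_diag_mul (a : H →L[ℂ] H) (α : ℕ → Circle) (i j : ℕ) :
    coef e i j (diag e α * a) = α i * coef e i j a := inner_diag e α i _

theorem norm_diag_sub_diag_le {α β : ℕ → Circle} {C : ℝ} (hC : 0 ≤ C)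
    (h : ∀ i, ‖(α i : ℂ) - β i‖ ≤ C) : ‖diag e α - diag e β‖ ≤ C := by
  refine ContinuousLinearMap.opNorm_le_bound _ hC fun x => ?_
  rw [← e.repr.norm_map, ← e.repr.norm_map x]
  have h1 : C * ‖e.repr x‖ = ‖(C : ℂ) • e.repr x‖ := by
    rw [norm_smul, Complex.norm_real, Real.norm_of_nonneg hC]
  rw [h1]
  refine lp.norm_mono two_ne_zero fun i => ?_
  rw [e.repr_apply_apply, lp.coeFn_smul, Pi.smul_apply, e.repr_apply_apply,
    sub_apply, inner_sub_right, inner_diag, inner_diag, ← sub_mul,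
    norm_mul, norm_smul, Complex.norm_real, Real.norm_of_nonneg hC]
  exact mul_le_mul_of_nonneg_right (h i) (norm_nonneg _)

/-- The diagonal projection onto the coordinates in `S`. -/
def mask (S : Set ℕ) : H →L[ℂ] H :=
  open Classical in (1 / 2 : ℂ) • (1 - diag e (fun i => if i ∈ S then -1 else 1))

theorem coef_mul_mask (a : H →L[ℂ] H) (S : Set ℕ) [DecidablePred (· ∈ S)] (i j : ℕ) :
    coef e i j (a * mask e S) = if j ∈ S then coef e i j a else 0 := by
  rw [mask, mul_smul_comm, mul_sub, mul_one, map_smul, map_sub, coef_mul_diag]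
  by_cases h : j ∈ S
  · simp only [h, if_true, Circle.coe_neg, Circle.coe_one, smul_eq_mul]
    ring
  · simp [h]

/-! ### Coordinate projections -/

/-- The projection onto the span of the first `n` basis vectors. -/
def proj (n : ℕ) : H →L[ℂ] H := ∑ j ∈ Finset.range n, rankOne ℂ (e j) (e j)

theorem isCompactOperator_rankOne (x y : H) : IsCompactOperator (rankOne ℂ x y) := by
  have h : IsCompactOperator (ContinuousLinearMap.toSpanSingleton ℂ x) :=
    isCompactOperator_of_locallyCompactSpace_rng _
  exact h.comp_clm (innerSL ℂ y)

theorem isCompactOperator_proj (n : ℕ) : IsCompactOperator (proj e n) :=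
  (compactIdeal H).sum_mem fun _ _ => isCompactOperator_rankOne _ _

theorem proj_basis (n j : ℕ) : proj e n (e j) = if j < n then e j else 0 := by
  simp [proj, inner_basis]

theorem star_proj (n : ℕ) : star (proj e n) = proj e n := by
  simp only [proj, star_sum]
  refine Finset.sum_congr rfl fun j _ => ?_
  rw [ContinuousLinearMap.star_eq_adjoint, adjoint_rankOne]

theorem inner_proj (n i : ℕ) (x : H) :
    inner ℂ (e i) (proj e n x) = if i < n then inner ℂ (e i) x else 0 := by
  rw [← ContinuousLinearMap.adjoint_inner_left, ← ContinuousLinearMap.star_eq_adjoint, star_proj,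
    proj_basis]
  split_ifs <;> simp

theorem coef_mul_proj (a : H →L[ℂ] H) (n i j : ℕ) :
    coef e i j (a * proj e n) = if j < n then coef e i j a else 0 := by
  simp only [coef_apply, mul_apply_eq_comp, proj_basis]
  split_ifs <;> simp

theorem coef_proj_mul (a : H →L[ℂ] H) (n i j : ℕ) :
    coef e i j (proj e n * a) = if i < n then coef e i j a else 0 := inner_proj e n i _

theorem tendsto_proj_apply (x : H) :
    Filter.Tendsto (fun n => proj e n x) Filter.atTop (nhds x) := by
  have h := (e.hasSum_repr x).tendsto_sum_nat
  simpa only [proj, FunLike.coe_sum, Finset.sum_apply, rankOne_apply,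
    sum_apply, e.repr_apply_apply] using h

theorem tendsto_proj_mul_mul_proj (a : H →L[ℂ] H) (n : ℕ) :
    Filter.Tendsto (fun m => ‖(1 - proj e m) * a * proj e n‖) Filter.atTop (nhds 0) := by
  have h : ∀ b : H →L[ℂ] H, b * a * proj e n =
      ∑ j ∈ Finset.range n, rankOne ℂ (b (a (e j))) (e j) := fun b => by
    rw [proj, Finset.mul_sum]
    refine Finset.sum_congr rfl fun j _ => ?_
    exact ContinuousLinearMap.ext fun x => by simp
  simp only [h]
  have h1 : ∀ j, Filter.Tendsto (fun m => rankOne ℂ ((1 - proj e m) (a (e j))) (e j))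
      Filter.atTop (nhds (0 : H →L[ℂ] H)) := fun j => by
    rw [tendsto_zero_iff_norm_tendsto_zero]
    simp only [norm_rankOne]
    have h2 := (tendsto_const_nhds (x := a (e j))).sub (tendsto_proj_apply e (a (e j)))
    rw [sub_self] at h2
    simpa using h2.norm.mul_const ‖e j‖
  have h2 := tendsto_finsetSum (Finset.range n) fun j _ => h1 j
  simpa using h2.norm

/-- A difference of diagonal unitaries is compact when its entries tend to zero. -/
theorem isCompactOperator_diag_sub_diag {α β : ℕ → Circle}
    (h : ∀ ε > 0, ∃ N, ∀ i, N ≤ i → ‖(α i : ℂ) - β i‖ ≤ ε) :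
    IsCompactOperator (diag e α - diag e β : H →L[ℂ] H) := by
  have hcl : IsClosed {a : H →L[ℂ] H | IsCompactOperator a} := isClosed_setOfPred_isCompactOperator
  refine hcl.closure_subset (Metric.mem_closure_iff.2 fun ε hε => ?_)
  obtain ⟨N, hN⟩ := h (ε / 2) (half_pos hε)
  have h0 : IsCompactOperator ((diag e α - diag e β) * proj e N : H →L[ℂ] H) :=
    (isCompactOperator_proj e N).clm_comp (diag e α - diag e β)
  refine ⟨(diag e α - diag e β) * proj e N, h0, ?_⟩
  have h1 : diag e α - diag e β - (diag e α - diag e β) * proj e N =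
      diag e (fun i => if i < N then β i else α i) - diag e β := by
    refine ext_basis e fun j => ?_
    simp only [sub_apply, mul_apply_eq_comp, proj_basis,
      diag_basis]
    split_ifs <;> simp [diag_basis]
  rw [dist_eq_norm, h1]
  refine (norm_diag_sub_diag_le e (half_pos hε).le fun i => ?_).trans_lt (half_lt_self hε)
  split_ifs with hi
  · simpa using (half_pos hε).le
  · exact hN i (not_lt.1 hi)

variable {e}

/-- `u_γ` commutes modulo compact operators with `D[E]` when `γ` is slowly varying on `E`. -/
theorem SlowOnBlocks.isCompactOperator_commutator {E : IntervalPartition} {γ : ℕ → Circle}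
    (hγ : SlowOnBlocks E γ) {a : H →L[ℂ] H} (ha : a ∈ fdd e E) :
    IsCompactOperator (diag e γ * a - a * diag e γ : H →L[ℂ] H) := by
  set γ' : ℕ → Circle := fun i => γ (E.cut (E.index i))
  have h1 : diag e γ' * a = a * diag e γ' := ext_coef e fun i j => by
    rw [coef_diag_mul, coef_mul_diag, mul_comm]
    by_cases hij : E.index i = E.index j
    · simp only [γ', hij]
    · rw [mem_fdd_iff.1 ha i j hij, zero_mul, zero_mul]
  have h2 : IsCompactOperator (diag e γ - diag e γ' : H →L[ℂ] H) := by
    refine isCompactOperator_diag_sub_diag e fun ε hε => ?_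
    obtain ⟨N, hN⟩ := hγ ε hε
    refine ⟨E.cut N, fun i hi => (hN _ i (E.mem_block_index i) _
      (mem_block.2 ⟨le_rfl, E.strictMono (Nat.lt_succ_self _)⟩)
      (E.strictMono.le_apply.trans hi) ((le_index hi).trans E.strictMono.le_apply)).le⟩
  have h3 : diag e γ * a - a * diag e γ =
      (diag e γ - diag e γ') * a - a * (diag e γ - diag e γ') := by
    rw [sub_mul, mul_sub, h1]; abel
  rw [h3]
  exact (h2.comp_clm a).sub (h2.clm_comp a)

/-! ### Decompositions -/

/-- Every operator is a compact perturbation of a block tridiagonal one. -/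
theorem exists_tridiagonal (a : H →L[ℂ] H) :
    ∃ (E : IntervalPartition) (b : H →L[ℂ] H), IsCompactOperator (a - b : H →L[ℂ] H) ∧
      ∀ i j, E.index i + 1 < E.index j ∨ E.index j + 1 < E.index i → coef e i j b = 0 := by
  have h : ∀ n k : ℕ, ∃ M, ∀ m ≥ M, ‖(1 - proj e m) * a * proj e k‖ ≤ (1 / 2) ^ n ∧
      ‖proj e k * a * (1 - proj e m)‖ ≤ (1 / 2) ^ n := fun n k => by
    have hp : (0 : ℝ) < (1 / 2) ^ n := by positivity
    have h1 := (tendsto_proj_mul_mul_proj e a k).eventually_lt_const hp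
    have h2 := (tendsto_proj_mul_mul_proj e (star a) k).eventually_lt_const hp
    obtain ⟨M, hM⟩ := Filter.eventually_atTop.1 (h1.and h2)
    refine ⟨M, fun m hm => ⟨(hM m hm).1.le, ?_⟩⟩
    rw [← norm_star]
    simpa only [star_mul, star_sub, star_one, star_proj, ← mul_assoc] using (hM m hm).2.le
  choose f hf using h
  set E := ofStep f
  set p : ℕ → H →L[ℂ] H := fun n => proj e (E.cut n)
  have hE : ∀ m n, n < m → ‖(1 - p m) * a * p n‖ ≤ (1 / 2) ^ n ∧
      ‖p n * a * (1 - p m)‖ ≤ (1 / 2) ^ n := fun m n hmn =>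
    hf n _ _ ((le_cut_ofStep f n).trans (E.strictMono.monotone hmn))
  set c : ℕ → H →L[ℂ] H := fun n =>
    (1 - p (n + 2)) * a * (p (n + 1) - p n) + (p (n + 1) - p n) * a * (1 - p (n + 2))
  have hp : ∀ n, IsCompactOperator (p n) := fun n => isCompactOperator_proj e _
  have hc : ∀ n, IsCompactOperator (c n) := fun n =>
    (compactIdeal H).add_mem
      (Ideal.mul_mem_left _ _ ((compactIdeal H).sub_mem (hp (n + 1)) (hp n)))
      (Ideal.mul_mem_right _ _
        (Ideal.mul_mem_right _ _ ((compactIdeal H).sub_mem (hp (n + 1)) (hp n))))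
  have hnorm : ∀ n, ‖c n‖ ≤ 4 * (1 / 2) ^ n := fun n => by
    have e1 := hE (n + 2) (n + 1) (by omega)
    have e2 := hE (n + 2) n (by omega)
    have e3 : ((1 / 2 : ℝ)) ^ (n + 1) ≤ (1 / 2) ^ n :=
      pow_le_pow_of_le_one (by norm_num) (by norm_num) n.le_succ
    simp only [c, mul_sub ((1 - p (n + 2)) * a), sub_mul (p (n + 1)) (p n) a,
      sub_mul (p (n + 1) * a) (p n * a)]
    refine (norm_add_le _ _).trans ?_
    have e4 := norm_sub_le ((1 - p (n + 2)) * a * p (n + 1)) ((1 - p (n + 2)) * a * p n)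
    have e5 := norm_sub_le (p (n + 1) * a * (1 - p (n + 2))) (p n * a * (1 - p (n + 2)))
    linarith [e1.1, e1.2, e2.1, e2.2]
  have hsum : Summable c := Summable.of_norm_bounded
    ((summable_geometric_of_lt_one (by norm_num) (by norm_num)).mul_left 4) hnorm
  have hcl : IsClosed {a : H →L[ℂ] H | IsCompactOperator a} := isClosed_setOfPred_isCompactOperator
  have hct : IsCompactOperator (∑' n, c n : H →L[ℂ] H) :=
    hcl.mem_of_tendsto hsum.hasSum (Filter.Eventually.of_forall fun s =>
      (compactIdeal H).sum_mem fun n _ => hc n)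
  refine ⟨E, a - ∑' n, c n, by rwa [sub_sub_cancel], fun i j hij => ?_⟩
  have hcoef : ∀ n, coef e i j (c n) =
      (if n + 2 ≤ E.index i ∧ E.index j = n then coef e i j a else 0) +
      (if n + 2 ≤ E.index j ∧ E.index i = n then coef e i j a else 0) := fun n => by
    have hlt : ∀ k m, k < E.cut m ↔ E.index k < m := fun k m => by
      constructor
      · intro h
        exact E.strictMono.lt_iff_lt.1 ((mem_block.1 (E.mem_block_index k)).1.trans_lt h)
      · intro h
        exact (mem_block.1 (E.mem_block_index k)).2.trans_le (E.strictMono.monotone h)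
    simp only [c, p, mul_sub, sub_mul, one_mul, mul_one, map_add, map_sub, mul_assoc,
      coef_proj_mul, coef_mul_proj, hlt]
    split_ifs <;> first | omega | simp
  have hs := hsum.hasSum.mapL (coef e i j)
  simp only [hcoef] at hs
  rw [map_sub, sub_eq_zero]
  rcases hij with hij | hij
  · refine HasSum.unique ?_ hs
    convert hasSum_single (f := fun n => (if n + 2 ≤ E.index i ∧ E.index j = n then coef e i j a else 0) +
      (if n + 2 ≤ E.index j ∧ E.index i = n then coef e i j a else 0)) (E.index i) ?_ using 1
    · rw [if_neg (by omega), if_pos (by omega), zero_add]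
    · intro n hn
      rw [if_neg (by omega), if_neg (by omega), zero_add]
  · refine HasSum.unique ?_ hs
    convert hasSum_single (f := fun n => (if n + 2 ≤ E.index i ∧ E.index j = n then coef e i j a else 0) +
      (if n + 2 ≤ E.index j ∧ E.index i = n then coef e i j a else 0)) (E.index j) ?_ using 1
    · rw [if_pos (by omega), if_neg (by omega), add_zero]
    · intro n hn
      rw [if_neg (by omega), if_neg (by omega), zero_add]

/-- Every operator is a sum of elements of `D[E^even]`, `D[E^odd]` and a compact operator, for a
suitable `E`. -/
theorem exists_even_odd_decomposition (e : HilbertBasis ℕ ℂ H) (a : H →L[ℂ] H) :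
    ∃ (E : IntervalPartition) (b c : H →L[ℂ] H), b ∈ fdd e E.even ∧ c ∈ fdd e E.odd ∧
      IsCompactOperator (a - (b + c) : H →L[ℂ] H) := by
  obtain ⟨E, t, hat, ht⟩ := exists_tridiagonal (e := e) a
  set α : ℕ → Circle := fun i => (-1) ^ E.even.index i
  set u := diag e α
  have hu : ∀ i j, coef e i j (u * t * u) = α i * coef e i j t * α j := fun i j => by
    rw [coef_mul_diag, coef_diag_mul]
  refine ⟨E, (1 / 2 : ℂ) • (t + u * t * u), (1 / 2 : ℂ) • (t - u * t * u),
    mem_fdd_iff.2 fun i j hij => ?_, mem_fdd_iff.2 fun i j hij => ?_, ?_⟩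
  · by_cases h : E.index i + 1 < E.index j ∨ E.index j + 1 < E.index i
    · rw [map_smul, map_add, hu, ht i j h]; simp
    · have h1 : E.even.index i = E.even.index j + 1 ∨ E.even.index j = E.even.index i + 1 := by
        rw [index_even, index_even] at hij ⊢
        omega
      have h2 : (α i : ℂ) * α j = -1 := by
        simp only [α]
        rcases h1 with h1 | h1 <;> rw [h1, ← Circle.coe_mul, pow_succ, ← Circle.coe_one,
          ← Circle.coe_neg] <;> congr 1
        · rw [mul_right_comm, ← mul_pow]; simp; rfl
        · rw [← mul_assoc, ← mul_pow]; simp; rfl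
      rw [map_smul, map_add, hu, mul_right_comm, h2]; simp
  · by_cases h : E.index i + 1 < E.index j ∨ E.index j + 1 < E.index i
    · rw [map_smul, map_sub, hu, ht i j h]; simp
    · have h1 : E.even.index i = E.even.index j := by
        rw [index_odd, index_odd] at hij
        rw [index_even, index_even]
        omega
      have h2 : (α i : ℂ) * α j = 1 := by
        simp only [α]
        rw [h1, ← Circle.coe_mul, ← mul_pow]
        simp
      rw [map_smul, map_sub, hu, mul_right_comm, h2]; simp
  · rw [← smul_add, add_add_sub_cancel, ← two_smul ℂ t, smul_smul]
    simpa using hat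

/-- If almost every interval of `E` is included in the union of two adjacent intervals of `F`,
then elements of `D[E]` split modulo compact operators along `F`. -/
theorem exists_split {E F : IntervalPartition} (h : ∃ N, ∀ n ≥ N, ∃ j, E.block n ⊆ F.pair j)
    {a : H →L[ℂ] H} (ha : a ∈ fdd e E) :
    ∃ b c : H →L[ℂ] H, b ∈ fdd e F.even ∧ c ∈ fdd e F.odd ∧
      IsCompactOperator (a - (b + c) : H →L[ℂ] H) := by
  classical
  obtain ⟨N, hN⟩ := h
  choose! g hg using hN
  have hmem : ∀ i, N ≤ E.index i → F.index i = g (E.index i) ∨ F.index i = g (E.index i) + 1 :=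
    fun i hi => (hg _ hi (E.mem_block_index i)).imp index_eq index_eq
  refine ⟨a * mask e {i | N ≤ E.index i ∧ Even (g (E.index i))},
    a * mask e {i | N ≤ E.index i ∧ ¬ Even (g (E.index i))},
    mem_fdd_iff.2 fun i j hij => ?_, mem_fdd_iff.2 fun i j hij => ?_, ?_⟩
  · rw [coef_mul_mask]
    refine ite_eq_right_iff.2 fun hj => mem_fdd_iff.1 ha i j fun h => hij ?_
    obtain ⟨hj1, hj2⟩ := hj
    rw [index_even, index_even]
    have h1 := hmem j hj1
    have h2 := hmem i (h ▸ hj1)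
    rw [h] at h2
    rw [Nat.even_iff] at hj2
    omega
  · rw [coef_mul_mask]
    refine ite_eq_right_iff.2 fun hj => mem_fdd_iff.1 ha i j fun h => hij ?_
    obtain ⟨hj1, hj2⟩ := hj
    rw [index_odd, index_odd]
    have h1 := hmem j hj1
    have h2 := hmem i (h ▸ hj1)
    rw [h] at h2
    rw [Nat.even_iff] at hj2
    omega
  · have h1 : a - (a * mask e {i | N ≤ E.index i ∧ Even (g (E.index i))} +
        a * mask e {i | N ≤ E.index i ∧ ¬ Even (g (E.index i))}) = a * mask e {i | E.index i < N} := by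
      refine ext_coef e fun i j => ?_
      simp only [map_sub, map_add, coef_mul_mask, Set.mem_ofPred_eq]
      by_cases h1 : N ≤ E.index j <;> by_cases h2 : Even (g (E.index j)) <;>
        simp [h1, h2, not_lt.2, not_le.1]
    have h2 : a * mask e {i | E.index i < N} = a * proj e (E.cut N) := by
      refine ext_coef e fun i j => ?_
      rw [coef_mul_mask, coef_mul_proj]
      have : E.index j < N ↔ j < E.cut N := by
        have := mem_block.1 (E.mem_block_index j)
        constructor
        · intro h
          exact this.2.trans_le (E.strictMono.monotone h)
        · intro h
          exact E.strictMono.lt_iff_lt.1 (this.1.trans_lt h)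
      simp only [Set.mem_ofPred_eq, this]
    rw [h1, h2]
    exact (isCompactOperator_proj e _).clm_comp a

/-! ### A noncompact commutator -/

theorem not_isCompactOperator_of_orthonormal {T : H →L[ℂ] H} {p q : ℕ → ℕ} {c : ℂ} (hc : c ≠ 0)
    (hq : Function.Injective q) (h : ∀ n, T (e (p n)) = c • e (q n)) : ¬ IsCompactOperator T := by
  intro hT
  obtain ⟨K, hK, hTK⟩ := hT.image_closedBall_subset_compact (f := T.toLinearMap) 1
  have hmem : ∀ n, c • e (q n) ∈ K := fun n => hTK ⟨e (p n), by
    rw [mem_closedBall_zero_iff, e.orthonormal.1], h n⟩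
  obtain ⟨x, -, φ, hφ, hx⟩ := hK.tendsto_subseq hmem
  obtain ⟨N, hN⟩ := Metric.cauchySeq_iff.1 hx.cauchySeq ‖c‖ (norm_pos_iff.2 hc)
  have h1 := hN N le_rfl (N + 1) N.le_succ
  have hne : q (φ N) ≠ q (φ (N + 1)) := fun h => by
    have := hφ.injective (hq h)
    omega
  simp only [Function.comp_apply, dist_eq_norm] at h1
  have h2 : inner ℂ (e (q (φ N))) (c • e (q (φ N)) - c • e (q (φ (N + 1)))) = c := by
    rw [inner_sub_right, inner_smul_right, inner_smul_right, inner_basis, inner_basis,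
      if_pos rfl, if_neg hne]
    ring
  have h3 := norm_inner_le_norm (𝕜 := ℂ) (e (q (φ N))) (c • e (q (φ N)) - c • e (q (φ (N + 1))))
  rw [h2, e.orthonormal.1, one_mul] at h3
  linarith

variable (e) in
theorem exists_perm_operator (σ : Equiv.Perm ℕ) : ∃ V : H →L[ℂ] H, ∀ i, V (e i) = e (σ i) := by
  classical
  let e' : HilbertBasis ℕ ℂ H := HilbertBasis.mk (v := e ∘ σ)
    (e.orthonormal.comp σ σ.injective) (by rw [σ.surjective.range_comp]; exact e.dense_span.ge)
  refine ⟨((e.repr.trans e'.repr.symm).toContinuousLinearEquiv : H →L[ℂ] H), fun i => ?_⟩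
  simp [e', HilbertBasis.repr_self, HilbertBasis.repr_symm_single]

/-- If `γ` oscillates between `1` and `-1` along the endpoints of `F`, then `u_γ` does not commute
with `D[F^even]` modulo compact operators. -/
theorem exists_not_isCompactOperator_commutator {F : IntervalPartition} {γ : ℕ → Circle}
    (hγ : ∀ m, γ (F.cut m) = (-1) ^ m) :
    ∃ V ∈ fdd e F.even, ¬ IsCompactOperator (diag e γ * V - V * diag e γ : H →L[ℂ] H) := by
  classical
  let s : ℕ → ℕ := fun i => if i = F.cut (F.index i) then
    (if Even (F.index i) then F.cut (F.index i + 1) else F.cut (F.index i - 1)) else i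
  have hs0 : ∀ n, s (F.cut (2 * n)) = F.cut (2 * n + 1) := fun n => by
    simp [s, index_cut]
  have hs1 : ∀ n, s (F.cut (2 * n + 1)) = F.cut (2 * n) := fun n => by
    simp [s, index_cut]
  have hcases : ∀ i, (∃ n, i = F.cut (2 * n)) ∨ (∃ n, i = F.cut (2 * n + 1)) ∨ s i = i := fun i => by
    by_cases h : i = F.cut (F.index i)
    · rcases Nat.even_or_odd' (F.index i) with ⟨n, hn | hn⟩
      · exact Or.inl ⟨n, hn ▸ h⟩
      · exact Or.inr (Or.inl ⟨n, hn ▸ h⟩)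
    · exact Or.inr (Or.inr (by simp only [s, if_neg h]))
  have hinv : Function.Involutive s := fun i => by
    rcases hcases i with ⟨n, rfl⟩ | ⟨n, rfl⟩ | h
    · rw [hs0, hs1]
    · rw [hs1, hs0]
    · rw [h, h]
  obtain ⟨V, hV⟩ := exists_perm_operator e hinv.toPerm
  refine ⟨V, mem_fdd_iff.2 fun i j hij => ?_, ?_⟩
  · rw [coef_apply, hV, inner_basis, Function.Involutive.coe_toPerm]
    refine if_neg fun h => hij ?_
    rw [h, index_even, index_even]
    rcases hcases j with ⟨n, rfl⟩ | ⟨n, rfl⟩ | h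
    · rw [hs0, index_cut, index_cut]; omega
    · rw [hs1, index_cut, index_cut]; omega
    · rw [h]
  · refine not_isCompactOperator_of_orthonormal (e := e) (p := fun n => F.cut (2 * n))
      (q := fun n => F.cut (2 * n + 1)) (c := -2) (by norm_num)
      (fun a b h => by have := F.strictMono.injective h; omega) fun n => ?_
    simp only [sub_apply, mul_apply_eq_comp, diag_basis, hV,
      Function.Involutive.coe_toPerm, hs0, map_smul, hγ]
    rw [← sub_smul]
    congr 1
    simp [pow_succ, pow_mul]
    norm_num

end CalkinCH

namespace CalkinCH

open IntervalPartition

/-! ### Countable ordinals and transfinite recursion -/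

theorem exists_transfinite_sequence {Ω X : Type*} [LinearOrder Ω] [WellFoundedLT Ω] [Nonempty X]
    (R : X → X → Prop) (Q : Ω → X → Prop)
    (step : ∀ (η : Ω) (g : Set.Iio η → X), (∀ ξ ζ, ξ < ζ → R (g ξ) (g ζ)) →
      ∃ x, (∀ ξ, R (g ξ) x) ∧ Q η x) :
    ∃ f : Ω → X, (∀ ξ η, ξ < η → R (f ξ) (f η)) ∧ ∀ η, Q η (f η) := by
  let F : (η : Ω) → ((ξ : Ω) → ξ < η → X) → X := fun η ih =>
    Classical.epsilon fun x => (∀ ξ : Set.Iio η, R (ih ξ ξ.2) x) ∧ Q η x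
  let f : Ω → X := WellFoundedLT.fix F
  have hf : ∀ η, f η = Classical.epsilon fun x => (∀ ξ : Set.Iio η, R (f ξ) x) ∧ Q η x :=
    fun η => WellFoundedLT.fix_eq F η
  have key : ∀ η, (∀ ξ : Set.Iio η, R (f ξ) (f η)) ∧ Q η (f η) := fun η => by
    induction η using WellFoundedLT.induction with
    | ind η ih =>
      have h := Classical.epsilon_spec
        (step η (fun ξ => f ξ) fun ξ ζ hξζ => (ih ζ ζ.2).1 ⟨ξ, hξζ⟩)
      rw [← hf] at h
      exact h
  exact ⟨f, fun ξ η h => (key η).1 ⟨ξ, h⟩, fun η => (key η).2⟩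

theorem Omega1.countable_Iio (η : Omega1) : Countable (Set.Iio η) := by
  have h : (η : Ordinal.{0}).card < Cardinal.aleph 1 := by
    rw [← Cardinal.lt_omega_iff_card_lt]
    exact η.2
  have h1 : Countable (Set.Iio (η : Ordinal.{0})) := by
    rw [← Cardinal.mk_le_aleph0_iff, Cardinal.mk_Iio_ordinal, Cardinal.lift_le_aleph0]
    rwa [← Cardinal.succ_aleph0, Order.lt_succ_iff] at h
  exact Function.Injective.countable
    (f := fun ξ : Set.Iio η => (⟨ξ.1.1, ξ.2⟩ : Set.Iio (η : Ordinal.{0})))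
    fun a b hab => by
      have h : (a.1.1 : Ordinal.{0}) = b.1.1 :=
        congrArg (fun x : Set.Iio (η : Ordinal.{0}) => (x : Ordinal.{0})) hab
      exact Subtype.ext (Subtype.ext h)

theorem Omega1.exists_upper_bound (f : ℕ → Omega1) : ∃ η, ∀ n, f n ≤ η := by
  refine ⟨⟨⨆ n, (f n : Ordinal.{0}), Ordinal.iSup_lt_omega_one fun n => (f n).2⟩, fun n => ?_⟩
  exact Ordinal.le_iSup (fun n => (f n : Ordinal.{0})) n

instance : Nonempty Omega1 := ⟨⟨0, Ordinal.omega_pos 1⟩⟩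

theorem exists_cofinal_sequence (ι : Type*) [Countable ι] [Nonempty ι] [LinearOrder ι] :
    ∃ s : ℕ → ι, Monotone s ∧ ∀ ξ, ∃ n, ξ ≤ s n := by
  obtain ⟨f, hf⟩ := exists_surjective_nat ι
  refine ⟨partialSups f, (partialSups f).monotone, fun ξ => ?_⟩
  obtain ⟨n, rfl⟩ := hf ξ
  exact ⟨n, le_partialSups f n⟩

/-- The pointwise eventual value of a pointwise eventually constant family of *-automorphisms
whose inverses are pointwise eventually constant is a *-automorphism. -/
theorem exists_eventual_starAlgEquiv {Ω A : Type*} [LinearOrder Ω] [Nonempty Ω] [Ring A]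
    [Algebra ℂ A] [StarRing A] (ψ : Ω → A ≃⋆ₐ[ℂ] A)
    (h₁ : ∀ x, ∃ ξ, ∀ η ≥ ξ, ψ η x = ψ ξ x) (h₂ : ∀ x, ∃ ξ, ∀ η ≥ ξ, (ψ η).symm x = (ψ ξ).symm x) :
    ∃ Φ : A ≃⋆ₐ[ℂ] A, ∀ x, ∃ ξ, ∀ η ≥ ξ, Φ x = ψ η x := by
  choose i hi using h₁
  choose k hk using h₂
  have hi' : ∀ x, ∀ η ≥ i x, ψ (i x) x = ψ η x := fun x η h => (hi x η h).symm
  have hk' : ∀ x, ∀ η ≥ k x, (ψ (k x)).symm x = (ψ η).symm x := fun x η h => (hk x η h).symm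
  let Φ : A ≃⋆ₐ[ℂ] A :=
    { toFun := fun x => ψ (i x) x
      invFun := fun x => (ψ (k x)).symm x
      left_inv := fun x => by
        show (ψ (k (ψ (i x) x))).symm (ψ (i x) x) = x
        have h := hi' x _ (le_max_right (k (ψ (i x) x)) (i x))
        rw [hk' _ _ (le_max_left (k (ψ (i x) x)) (i x))]
        exact (congrArg _ h).trans ((ψ _).symm_apply_apply x)
      right_inv := fun x => by
        show ψ (i ((ψ (k x)).symm x)) ((ψ (k x)).symm x) = x
        have h := hk' x _ (le_max_right (i ((ψ (k x)).symm x)) (k x))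
        rw [hi' _ _ (le_max_left (i ((ψ (k x)).symm x)) (k x))]
        exact (congrArg _ h).trans ((ψ _).apply_symm_apply x)
      map_mul' := fun x y => by
        show ψ (i (x * y)) (x * y) = ψ (i x) x * ψ (i y) y
        set m := max (i (x * y)) (max (i x) (i y))
        rw [hi' (x * y) m (le_max_left _ _), hi' x m ((le_max_left _ _).trans (le_max_right _ _)),
          hi' y m ((le_max_right _ _).trans (le_max_right _ _)), map_mul]
      map_add' := fun x y => by
        show ψ (i (x + y)) (x + y) = ψ (i x) x + ψ (i y) y
        set m := max (i (x + y)) (max (i x) (i y))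
        rw [hi' (x + y) m (le_max_left _ _), hi' x m ((le_max_left _ _).trans (le_max_right _ _)),
          hi' y m ((le_max_right _ _).trans (le_max_right _ _)), map_add]
      map_star' := fun x => by
        show ψ (i (star x)) (star x) = star (ψ (i x) x)
        rw [hi' (star x) _ (le_max_left _ (i x)), hi' x _ (le_max_right (i (star x)) _), map_star]
      map_smul' := fun c x => by
        show ψ (i (c • x)) (c • x) = c • ψ (i x) x
        rw [hi' (c • x) _ (le_max_left _ (i x)), hi' x _ (le_max_right (i (c • x)) _), map_smul] }
  exact ⟨Φ, fun x => ⟨i x, hi' x⟩⟩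

variable {H : Type*} [NormedAddCommGroup H] [InnerProductSpace ℂ H] [CompleteSpace H]
  (e : HilbertBasis ℕ ℂ H)

/-! ### Inner automorphisms given by diagonal unitaries -/

/-- The images of the diagonal unitaries in the Calkin algebra. -/
def calkinDiag : (ℕ → Circle) →* unitary (Calkin H) where
  toFun α := ⟨toCalkin (diag e α), by
    have h := Unitary.mem_iff.1 (diagonalUnitary e α).2
    rw [Unitary.mem_iff, star_toCalkin, ← map_mul, ← map_mul]
    exact ⟨(congrArg toCalkin h.1).trans (map_one _), (congrArg toCalkin h.2).trans (map_one _)⟩⟩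
  map_one' := Subtype.ext (by
    show toCalkin (diag e 1) = 1
    rw [diag_one, map_one])
  map_mul' α β := Subtype.ext (by
    show toCalkin (diag e (α * β)) = toCalkin (diag e α) * toCalkin (diag e β)
    rw [diag_mul, map_mul])

/-- The automorphism of the Calkin algebra induced by `Ψ_α`. -/
def ad : (ℕ → Circle) →* (Calkin H ≃⋆ₐ[ℂ] Calkin H) :=
  (Unitary.conjStarAlgAut ℂ (Calkin H)).comp (calkinDiag e)

variable {e}

theorem ad_apply (α : ℕ → Circle) (x : Calkin H) :
    ad e α x = toCalkin (diag e α) * x * star (toCalkin (diag e α)) :=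
  Unitary.conjStarAlgAut_apply _ _

theorem ad_mul_apply (α β : ℕ → Circle) (x : Calkin H) : ad e (α * β) x = ad e α (ad e β x) := by
  rw [map_mul]; rfl

theorem ad_symm (α : ℕ → Circle) : (ad e α).symm = ad e α⁻¹ := by
  rw [map_inv]; rfl

theorem toCalkin_conjDiag (α : ℕ → Circle) (a : H →L[ℂ] H) :
    toCalkin (conjDiag e α a) = ad e α (toCalkin a) := by
  rw [ad_apply, star_toCalkin, ← map_mul, ← map_mul]
  rfl

theorem isInner_ad (α : ℕ → Circle) : IsInner (ad e α) := ⟨calkinDiag e α, rfl⟩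

theorem ad_eq_self_iff {γ : ℕ → Circle} {a : H →L[ℂ] H} :
    ad e γ (toCalkin a) = toCalkin a ↔
      IsCompactOperator (diag e γ * a - a * diag e γ : H →L[ℂ] H) := by
  have h1 : star (toCalkin (diag e γ)) * toCalkin (diag e γ) = 1 :=
    (Unitary.mem_iff.1 (calkinDiag e γ).2).1
  have h2 : toCalkin (diag e γ) * star (toCalkin (diag e γ)) = 1 :=
    (Unitary.mem_iff.1 (calkinDiag e γ).2).2
  rw [← toCalkin_eq_iff, map_mul, map_mul, ad_apply]
  constructor
  · intro h
    calc _ = toCalkin (diag e γ) * toCalkin a * (star (toCalkin (diag e γ)) * toCalkin (diag e γ)) := by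
          rw [h1, mul_one]
      _ = _ := by rw [← mul_assoc, h]
  · intro h
    rw [h, mul_assoc, h2, mul_one]

theorem SlowOnBlocks.ad_eq_self {E : IntervalPartition} {γ : ℕ → Circle} (hγ : SlowOnBlocks E γ)
    {a : H →L[ℂ] H} (ha : a ∈ fdd e E) : ad e γ (toCalkin a) = toCalkin a :=
  ad_eq_self_iff.2 (hγ.isCompactOperator_commutator ha)

theorem Slow.ad_eq_self_of_mem_evenOdd {E : IntervalPartition} {γ : ℕ → Circle} (hγ : Slow E γ)
    {a : H →L[ℂ] H} (ha : a ∈ evenOdd e E) : ad e γ (toCalkin a) = toCalkin a :=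
  ha.elim hγ.slowOnBlocks_even.ad_eq_self hγ.slowOnBlocks_odd.ad_eq_self

variable (e) in
theorem exists_forall_slow_ad_eq_self (x : Calkin H) :
    ∃ E, ∀ γ, Slow E γ → ad e γ x = x := by
  obtain ⟨a, rfl⟩ := toCalkin_surjective x
  obtain ⟨E, b, c, hb, hc, habc⟩ := exists_even_odd_decomposition e a
  refine ⟨E, fun γ hγ => ?_⟩
  rw [toCalkin_eq_iff.2 habc, map_add, map_add, hγ.slowOnBlocks_even.ad_eq_self hb,
    hγ.slowOnBlocks_odd.ad_eq_self hc]

theorem ad_eq_ad {α β : ℕ → Circle} {x : Calkin H} (h : ad e (α⁻¹ * β) x = x) :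
    ad e β x = ad e α x := by
  conv_rhs => rw [← h, ← ad_mul_apply, mul_inv_cancel_left]

theorem isClosed_ad_eq_self (γ : ℕ → Circle) : IsClosed {x : Calkin H | ad e γ x = x} := by
  have hcl : IsClosed {a : H →L[ℂ] H | IsCompactOperator a} := isClosed_setOfPred_isCompactOperator
  have hc : Continuous fun a : H →L[ℂ] H => diag e γ * a - a * diag e γ := by fun_prop
  have h : IsClosed {a : H →L[ℂ] H | ad e γ (toCalkin a) = toCalkin a} := by
    simp only [ad_eq_self_iff]
    exact hcl.preimage hc
  exact isClosed_coinduced.2 h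

theorem add_mem_fdd {E : IntervalPartition} {a b : H →L[ℂ] H} (ha : a ∈ fdd e E)
    (hb : b ∈ fdd e E) : a + b ∈ fdd e E :=
  fun n x hx => Submodule.add_mem _ (ha n x hx) (hb n x hx)

/-- Modulo compact operators, every operator is a sum of elements of `D[F^even]` and `D[F^odd]`
whenever `F` is coarse enough. -/
theorem exists_forall_even_odd_decomposition (e : HilbertBasis ℕ ℂ H) (a : H →L[ℂ] H) :
    ∃ E : IntervalPartition, ∀ F, E.AlmostLE F → ∃ b c : H →L[ℂ] H,
      b ∈ fdd e F.even ∧ c ∈ fdd e F.odd ∧ toCalkin a = toCalkin b + toCalkin c := by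
  obtain ⟨E, b, c, hb, hc, habc⟩ := exists_even_odd_decomposition e a
  refine ⟨E, fun F hEF => ?_⟩
  obtain ⟨N, hN⟩ := Filter.eventually_atTop.1 hEF
  obtain ⟨b₁, b₂, hb₁, hb₂, hbb⟩ := exists_split (E := E.even) (F := F) ⟨N, fun n hn => by
    obtain ⟨j, hj⟩ := hN (2 * n) (by omega)
    exact ⟨j, fun i hi => hj (mem_pair.2 hi)⟩⟩ hb
  obtain ⟨c₁, c₂, hc₁, hc₂, hcc⟩ := exists_split (E := E.odd) (F := F) ⟨N + 1, fun n hn => by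
    obtain ⟨j, hj⟩ := hN (2 * n - 1) (by omega)
    refine ⟨j, fun i hi => hj (mem_pair.2 ?_)⟩
    have hi : E.cut (2 * n - 1) ≤ i ∧ i < E.cut (2 * (n + 1) - 1) := hi
    exact ⟨hi.1, hi.2.trans_le (E.strictMono.monotone (by omega))⟩⟩ hc
  refine ⟨b₁ + c₁, b₂ + c₂, add_mem_fdd hb₁ hc₁, add_mem_fdd hb₂ hc₂, ?_⟩
  rw [toCalkin_eq_iff.2 habc, map_add, toCalkin_eq_iff.2 hbb, toCalkin_eq_iff.2 hcc, map_add,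
    map_add, map_add, map_add, add_add_add_comm]

/-! ### The recursive step -/

/-- A pair `(E, α)` is extended by `(F, β)`. -/
def Extends (p q : IntervalPartition × (ℕ → Circle)) : Prop :=
  p.1.AlmostLE q.1 ∧ Slow p.1 (p.2⁻¹ * q.2)

theorem Extends.refl (p : IntervalPartition × (ℕ → Circle)) : Extends p p :=
  ⟨AlmostLE.refl _, by rw [inv_mul_cancel]; exact Slow.one⟩

theorem Extends.trans {p q r : IntervalPartition × (ℕ → Circle)} (h₁ : Extends p q)
    (h₂ : Extends q r) : Extends p r :=
  ⟨h₁.1.trans h₂.1, by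
    have h := h₁.2.mul (h₂.2.mono h₁.1)
    rwa [mul_assoc, mul_inv_cancel_left] at h⟩

theorem exists_extension {ι : Type*} [Countable ι] [LinearOrder ι]
    {g : ι → IntervalPartition × (ℕ → Circle)} (hg : ∀ ξ η, ξ < η → Extends (g ξ) (g η))
    (F : IntervalPartition) : ∃ p, (∀ ξ, Extends (g ξ) p) ∧ F.AlmostLE p.1 := by
  rcases isEmpty_or_nonempty ι with h | h
  · exact ⟨(F, 1), fun ξ => isEmptyElim ξ, AlmostLE.refl F⟩
  obtain ⟨s, hs, hs'⟩ := exists_cofinal_sequence ι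
  have hle : ∀ ξ η, ξ ≤ η → Extends (g ξ) (g η) := fun ξ η h =>
    h.eq_or_lt.elim (fun h => h ▸ Extends.refl _) (hg ξ η)
  obtain ⟨β, hβ⟩ := exists_amalgamation (G := fun n => (g (s n)).1) (β := fun n => (g (s n)).2)
    (fun l n h => (hle _ _ (hs h)).1) (fun l n h => (hle _ _ (hs h)).2)
  obtain ⟨E, hE⟩ := IntervalPartition.exists_upper_bound
    (fun n => Nat.casesOn n F fun n => (g (s n)).1)
  refine ⟨(E, β), fun ξ => ?_, hE 0⟩
  obtain ⟨n, hn⟩ := hs' ξ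
  exact (hle _ _ hn).trans ⟨hE (n + 1), hβ n⟩

/-- A countable coherent family has an extension that is not implemented by a given unitary. -/
theorem exists_extension_ne {ι : Type*} [Countable ι] [LinearOrder ι]
    {g : ι → IntervalPartition × (ℕ → Circle)} (hg : ∀ ξ η, ξ < η → Extends (g ξ) (g η))
    (F : IntervalPartition) (e : HilbertBasis ℕ ℂ H) (Θ : Calkin H ≃⋆ₐ[ℂ] Calkin H) :
    ∃ p, (∀ ξ, Extends (g ξ) p) ∧ F.AlmostLE p.1 ∧
      ∃ a ∈ evenOdd e p.1, Θ (toCalkin a) ≠ ad e p.2 (toCalkin a) := by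
  obtain ⟨⟨E, β⟩, hp, hF⟩ := exists_extension hg F
  obtain ⟨γ, E', hγ, hEE', hγ'⟩ := exists_slow_oscillating E
  obtain ⟨V, hV, hVc⟩ := exists_not_isCompactOperator_commutator (e := e) hγ'
  rw [← ad_eq_self_iff] at hVc
  have h1 : Extends (E, β) (E', β) := ⟨hEE', by simpa using Slow.one⟩
  have h2 : Extends (E, β) (E', β * γ) := ⟨hEE', by simpa using hγ⟩
  by_cases h : Θ (toCalkin V) = ad e β (toCalkin V)
  · refine ⟨(E', β * γ), fun ξ => (hp ξ).trans h2, hF.trans hEE', V, Or.inl hV, fun h' => hVc ?_⟩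
    rw [h, ad_mul_apply] at h'
    exact ((ad e β).injective h').symm
  · exact ⟨(E', β), fun ξ => (hp ξ).trans h1, hF.trans hEE', V, Or.inl hV, h⟩

/-- Under the Continuum Hypothesis, the pairs of interval partitions and unitaries of the Calkin
algebra can be enumerated by the countable ordinals. -/
theorem exists_surjective_omega1 (e : HilbertBasis ℕ ℂ H)
    (continuumHypothesis : (Cardinal.continuum : Cardinal.{0}) = Cardinal.aleph 1) :
    ∃ f : Omega1 → IntervalPartition × unitary (Calkin H), Function.Surjective f := by
  have h1 : Nonempty (Omega1 ≃ (ℕ → ℕ) × (ℕ → ℕ → ℂ)) := by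
    rw [← Cardinal.lift_mk_eq', Cardinal.mk_Iio_ordinal, Ordinal.card_omega,
      ← continuumHypothesis]
    simp
  obtain ⟨f⟩ := h1
  have h2 : Function.Injective (IntervalPartition.cut) := fun E F h =>
    IntervalPartition.ext' (congrFun h)
  have h3 : Function.Injective (fun (a : H →L[ℂ] H) i j => coef e i j a) := fun a b h =>
    ext_coef e fun i j => congrFun (congrFun h i) j
  have : Nonempty IntervalPartition := ⟨IntervalPartition.singletons⟩
  have h4 := Function.invFun_surjective h2
  have h5 := Function.invFun_surjective h3
  have h6 := Function.invFun_surjective (Subtype.val_injective (p := (· ∈ unitary (Calkin H))))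
  have h7 := h4.prodMap ((h6.comp toCalkin_surjective).comp h5)
  exact ⟨_, h7.comp f.surjective⟩

end CalkinCH

end

open CalkinCH CalkinCH.IntervalPartition in
theorem theoremT1
    (continuumHypothesis : (Cardinal.continuum : Cardinal.{0}) = Cardinal.aleph 1)
    {H : Type*} [NormedAddCommGroup H] [InnerProductSpace ℂ H] [CompleteSpace H]
    (e : HilbertBasis ℕ ℂ H) :
    ∃ Φ : CalkinCH.Calkin H ≃⋆ₐ[ℂ] CalkinCH.Calkin H,
      CalkinCH.IsOuter Φ ∧
      CalkinCH.IsInnerOn Φ (CalkinCH.toCalkin '' CalkinCH.atomicMasa e) ∧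
      (∀ E : CalkinCH.IntervalPartition,
        CalkinCH.IsInnerOn Φ (CalkinCH.toCalkin '' CalkinCH.fdd e E)) ∧
      (∀ A : NonUnitalSubalgebra ℂ (CalkinCH.Calkin H),
        TopologicalSpace.IsSeparable (A : Set (CalkinCH.Calkin H)) →
          CalkinCH.IsInnerOn Φ (A : Set (CalkinCH.Calkin H))) ∧
      ∃ (E : CalkinCH.Omega1 → CalkinCH.IntervalPartition)
        (α : CalkinCH.Omega1 → ℕ → Circle),
        (∀ ξ η, ξ < η → (E ξ).AlmostLE (E η)) ∧
        (∀ F : CalkinCH.IntervalPartition, ∃ ξ, F.AlmostLE (E ξ)) ∧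
        (∀ ξ η, ξ ≤ η →
          CalkinCH.AgreeModCompacts e (α ξ) (α η) (CalkinCH.evenOdd e (E ξ))) ∧
        (∀ ξ, CalkinCH.RepresentsOn e Φ (α ξ) (CalkinCH.evenOdd e (E ξ))) ∧
        (∀ Φ' : CalkinCH.Calkin H ≃⋆ₐ[ℂ] CalkinCH.Calkin H,
          (∀ ξ, CalkinCH.RepresentsOn e Φ' (α ξ) (CalkinCH.evenOdd e (E ξ))) → Φ' = Φ) := by
  obtain ⟨b, hb⟩ := exists_surjective_omega1 e continuumHypothesis
  have : Nonempty IntervalPartition := ⟨IntervalPartition.singletons⟩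
  obtain ⟨f, hf, hQ⟩ := exists_transfinite_sequence (Ω := Omega1) Extends
    (fun η p => (b η).1.AlmostLE p.1 ∧ ∃ a ∈ evenOdd e p.1,
      Unitary.conjStarAlgAut ℂ (Calkin H) (b η).2 (toCalkin a) ≠ ad e p.2 (toCalkin a))
    fun η g hg => by
      have := Omega1.countable_Iio η
      exact exists_extension_ne hg _ e _
  have hle : ∀ ξ η, ξ ≤ η → Extends (f ξ) (f η) := fun ξ η h =>
    h.eq_or_lt.elim (fun h => h ▸ Extends.refl _) (hf ξ η)
  have hcof : ∀ F : IntervalPartition, ∃ ξ, F.AlmostLE (f ξ).1 := fun F => by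
    obtain ⟨ξ, hξ⟩ := hb (F, 1)
    exact ⟨ξ, by simpa [hξ] using (hQ ξ).1⟩
  have hfix : ∀ x : Calkin H, ∃ ξ, ∀ γ, Slow (f ξ).1 γ → ad e γ x = x := fun x => by
    obtain ⟨F, hF⟩ := exists_forall_slow_ad_eq_self e x
    obtain ⟨ξ, hξ⟩ := hcof F
    exact ⟨ξ, fun γ hγ => hF γ (hγ.mono hξ)⟩
  obtain ⟨Φ, hΦ⟩ := exists_eventual_starAlgEquiv (fun ξ => ad e (f ξ).2)
    (fun x => by
      obtain ⟨ξ, hξ⟩ := hfix x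
      exact ⟨ξ, fun η hη => ad_eq_ad (hξ _ (hle ξ η hη).2)⟩)
    (fun x => by
      obtain ⟨ξ, hξ⟩ := hfix x
      refine ⟨ξ, fun η hη => ?_⟩
      rw [ad_symm, ad_symm]
      refine ad_eq_ad (hξ _ ?_)
      rw [← mul_inv]
      exact (hle ξ η hη).2.inv)
  have hΦeq : ∀ ξ x, (∀ η ≥ ξ, ad e (f η).2 x = ad e (f ξ).2 x) → Φ x = ad e (f ξ).2 x := by
    intro ξ x h
    obtain ⟨ζ, hζ⟩ := hΦ x
    rw [hζ _ (le_max_left ζ ξ), h _ (le_max_right ζ ξ)]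
  have hagree : ∀ ξ η, ξ ≤ η → ∀ a ∈ evenOdd e (f ξ).1,
      ad e (f η).2 (toCalkin a) = ad e (f ξ).2 (toCalkin a) := fun ξ η h a ha =>
    ad_eq_ad ((hle ξ η h).2.ad_eq_self_of_mem_evenOdd ha)
  have hrep : ∀ ξ, ∀ a ∈ evenOdd e (f ξ).1, Φ (toCalkin a) = ad e (f ξ).2 (toCalkin a) :=
    fun ξ a ha => hΦeq ξ _ fun η hη => hagree ξ η hη a ha
  have hfdd : ∀ E : IntervalPartition, IsInnerOn Φ (toCalkin '' fdd e E) := fun E => by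
    obtain ⟨ξ, hξ⟩ := hcof E
    refine ⟨ad e (f ξ).2, isInner_ad _, ?_⟩
    rintro _ ⟨a, ha, rfl⟩
    exact hΦeq ξ _ fun η hη =>
      ad_eq_ad (((hle ξ η hη).2.mono hξ).slowOnBlocks_self.ad_eq_self ha)
  refine ⟨Φ, ?_, hfdd _, hfdd, ?_, fun ξ => (f ξ).1, fun ξ => (f ξ).2, fun ξ η h => (hf ξ η h).1,
    hcof, ?_, ?_, ?_⟩
  · rintro ⟨w, hw⟩
    obtain ⟨ξ, hξ⟩ := hb (IntervalPartition.singletons, w)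
    obtain ⟨a, ha, hne⟩ := (hQ ξ).2
    refine hne ?_
    rw [hξ, ← hrep ξ a ha, hw]
  · rintro A ⟨c, hc, hAc⟩
    have hbd : ∃ ξ, ∀ x ∈ c, ∀ η ≥ ξ, ad e ((f ξ).2⁻¹ * (f η).2) x = x := by
      choose i hi using hfix
      rcases c.eq_empty_or_nonempty with rfl | hne
      · exact ⟨Classical.arbitrary _, fun x hx => absurd hx (Set.notMem_empty x)⟩
      obtain ⟨s, rfl⟩ := hc.exists_eq_range hne
      obtain ⟨ξ, hξ⟩ := Omega1.exists_upper_bound fun n => i (s n)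
      refine ⟨ξ, ?_⟩
      rintro _ ⟨n, rfl⟩ η hη
      exact hi _ _ ((hle ξ η hη).2.mono (hle _ _ (hξ n)).1)
    obtain ⟨ξ, hξ⟩ := hbd
    refine ⟨ad e (f ξ).2, isInner_ad _, fun x hx => hΦeq ξ x fun η hη => ad_eq_ad ?_⟩
    exact closure_minimal (fun x hx => hξ x hx η hη) (isClosed_ad_eq_self _) (hAc hx)
  · intro ξ η h a ha
    rw [← toCalkin_eq_iff, toCalkin_conjDiag, toCalkin_conjDiag]
    exact (hagree ξ η h a ha).symm
  · intro ξ a ha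
    rw [toCalkin_conjDiag]
    exact hrep ξ a ha
  · intro Φ' hΦ'
    have heq : ∀ ξ, ∀ a ∈ evenOdd e (f ξ).1, Φ' (toCalkin a) = Φ (toCalkin a) := fun ξ a ha => by
      rw [hrep ξ a ha, hΦ' ξ a ha, toCalkin_conjDiag]
    refine StarAlgEquiv.ext fun x => ?_
    obtain ⟨a, rfl⟩ := toCalkin_surjective x
    obtain ⟨F, hF⟩ := exists_forall_even_odd_decomposition e a
    obtain ⟨ξ, hξ⟩ := hcof F
    obtain ⟨b, c, hb, hc, ha⟩ := hF _ hξ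
    simp only [ha, map_add, heq ξ b (Or.inl hb), heq ξ c (Or.inr hc)]
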